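/- Let $p,e>2$ be primes and let $$H=\left\{\begin{bmatrix}1&\alpha&\gamma\\0&1&\beta\\0&0&1\end{bmatrix}:\alpha,\beta,\gamma\in\mathbb{F}_{p^e}\right\}$$ be the Heisenberg group over the field $\mathbb{F}_{p^e}$ with $p^e$ elements, with commutator subgroup $H'$. For a finite group $G$, let $d(G)$ be the least size of a generating set of $G$. The subgroup profile of $G$ is the function that assigns to each isomorphism type of a group $J$ the number of proper subgroups $K<G$ with $K\cong J$; the quotient-group profile of $G$ is the function that assigns to each isomorphism type of a group $Q$ the number of normal subgroups $1\neq K\trianglelefteq G$ with $G/K\cong Q$. Then every subgroup $N\leq H'$ with $|H:N|=p^{2e+2}$ is normal in $H$. Any two groups in the family $$\mathcal{G}_{p,e}=\{H/N : N\leq H',\ |H:N|=p^{2e+2}\}$$ have the same subgroup profile and the same quotient-group profile, and $d(H/N)=2e$ for every $H/N\in\mathcal{G}_{p,e}$. Nevertheless, $\mathcal{G}_{p,e}$ contains at least $p^{e-3}/e$ isomorphism classes of groups. -/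

import Mathlib

namespace HeisenbergProfiles

universe u

/-- The upper unitriangular `3 × 3` matrix with entries `a = (1,2)`, `b = (2,3)`, `c = (1,3)`. -/
def unitri {F : Type u} [Field F] (a b c : F) : Matrix (Fin 3) (Fin 3) F :=
  !![1, a, c; 0, 1, b; 0, 0, 1]

theorem unitri_mul {F : Type u} [Field F] (a b c a' b' c' : F) :
    unitri a b c * unitri a' b' c' = unitri (a + a') (b + b') (c + c' + a * b') := by
  ext i j
  fin_cases i <;> fin_cases j <;>
    simp [unitri, Matrix.mul_apply, Fin.sum_univ_three] <;> ring

theorem unitri_zero {F : Type u} [Field F] : unitri (0 : F) 0 0 = 1 := by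
  ext i j
  fin_cases i <;> fin_cases j <;> simp [unitri]

/-- The Heisenberg group over `F`: all upper unitriangular `3 × 3` matrices over `F`,
as a subgroup of `GL₃(F)`. -/
def heisenberg (F : Type u) [Field F] : Subgroup (Matrix.GeneralLinearGroup (Fin 3) F) where
  carrier := {g | ∃ a b c : F, (g : Matrix (Fin 3) (Fin 3) F) = unitri a b c}
  one_mem' := ⟨0, 0, 0, by rw [unitri_zero]; rfl⟩
  mul_mem' := by
    rintro g h ⟨a, b, c, hg⟩ ⟨a', b', c', hh⟩
    exact ⟨a + a', b + b', c + c' + a * b', by rw [Units.val_mul, hg, hh, unitri_mul]⟩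
  inv_mem' := by
    rintro g ⟨a, b, c, hg⟩
    refine ⟨-a, -b, -c + a * b, ?_⟩
    have key : (g : Matrix (Fin 3) (Fin 3) F) * unitri (-a) (-b) (-c + a * b) = 1 := by
      rw [hg, unitri_mul, ← unitri_zero]
      congr 1 <;> ring
    calc ((g⁻¹ : Matrix.GeneralLinearGroup (Fin 3) F) : Matrix (Fin 3) (Fin 3) F)
        = (g⁻¹ : Matrix.GeneralLinearGroup (Fin 3) F) *
            ((g : Matrix (Fin 3) (Fin 3) F) * unitri (-a) (-b) (-c + a * b)) := by
          rw [key, mul_one]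
      _ = unitri (-a) (-b) (-c + a * b) := by
          rw [← mul_assoc, ← Units.val_mul, inv_mul_cancel, Units.val_one, one_mul]

/-- The subgroup profile of a (finite) group `G`, as a function of isomorphism types:
the number of proper subgroups of `G` that are isomorphic to `J`. -/
noncomputable def subgroupProfile (G : Type u) [Group G] (J : Type u) [Group J] : ℕ :=
  Nat.card {K : Subgroup G // K ≠ ⊤ ∧ Nonempty (K ≃* J)}

/-- The quotient-group profile of a (finite) group `G`, as a function of isomorphism types:
the number of proper quotients `G ⧸ K` (that is, of normal subgroups `K ≠ 1`) that are
isomorphic to `Q`. -/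
noncomputable def quotientProfile (G : Type u) [Group G] (Q : Type u) [Group Q] : ℕ :=
  Nat.card {K : Subgroup G // K ≠ ⊥ ∧ ∃ _ : K.Normal, Nonempty (G ⧸ K ≃* Q)}

/-- `G₁` and `G₂` have, for every isomorphism type, equally many proper subgroups of that type. -/
def SameSubgroupProfile (G₁ G₂ : Type u) [Group G₁] [Group G₂] : Prop :=
  ∀ (J : Type u) [Group J], subgroupProfile G₁ J = subgroupProfile G₂ J

/-- `G₁` and `G₂` have, for every isomorphism type, equally many proper quotients of that type. -/
def SameQuotientProfile (G₁ G₂ : Type u) [Group G₁] [Group G₂] : Prop :=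
  ∀ (Q : Type u) [Group Q], quotientProfile G₁ Q = quotientProfile G₂ Q

/-- The condition on the kernels: `N ≤ H'` and `|H : N| = p ^ (2e + 2)`, where `H` is the
Heisenberg group over `F`. -/
def IsKernel (p e : ℕ) (F : Type u) [Field F] (N : Subgroup (heisenberg F)) : Prop :=
  N ≤ commutator (heisenberg F) ∧ N.index = p ^ (2 * e + 2)

/-- Index type of the family of the quotients `H ⧸ N`. Normality is listed so that `H ⧸ N` is a
group. -/
def Kernel (p e : ℕ) (F : Type u) [Field F] : Type u :=
  {N : Subgroup (heisenberg F) // IsKernel p e F N ∧ N.Normal}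

instance (p e : ℕ) (F : Type u) [Field F] (N : Kernel p e F) : N.1.Normal := N.2.2

/-- The member `H ⧸ N` of the family. -/
abbrev Kernel.Quot {p e : ℕ} {F : Type u} [Field F] (N : Kernel p e F) : Type u :=
  heisenberg F ⧸ N.1

/-- Two members of the family are equivalent when the groups are isomorphic. -/
def isoSetoid (p e : ℕ) (F : Type u) [Field F] : Setoid (Kernel p e F) where
  r N N' := Nonempty (N.Quot ≃* N'.Quot)
  iseqv := ⟨fun _ => ⟨MulEquiv.refl _⟩, fun ⟨f⟩ => ⟨f.symm⟩, fun ⟨f⟩ ⟨g⟩ => ⟨f.trans g⟩⟩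

/-- The isomorphism classes of the groups in the family. -/
abbrev IsoClasses (p e : ℕ) (F : Type u) [Field F] : Type u :=
  Quotient (isoSetoid p e F)

end HeisenbergProfiles

namespace HeisenbergProfiles

universe u v

open Module
open scoped commutatorElement

/-! ### Central extensions defined by a bilinear cocycle -/

/-! For odd `p`, replacing `z` by `2z - ab` turns the Heisenberg cocycle into the determinant form
on `F × F`. Fix a nonzero functional `lam` on `F`. Every functional is `lam (d * ·)` for some `d`,
so a kernel of index `p ^ (2e + 2)` is cut out by two independent ones, with multipliers `d` and
`d'`. After rescaling by `d`, the quotient is the group of `form lam c` with `c = d' / d` outside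
the prime field (`Kernel.exists_mulEquiv`). It remains to compare these groups for different `c`.

Subgroups: commutators fill the centre, so a proper subgroup lies over a hyperplane `ker φ` of `F ×
F`. As `e` is prime, `c` and `c'` both generate `F`, and `c ^ i ↦ c' ^ i` intertwines the two
multiplications except at the top power. This gives a linear bijection fixing `φ` and an isometry of
the two forms on `ker φ` (`exists_isometry_on_hyperplane`), hence a bijection of the subgroups over
`ker φ`; a weighted count over all `φ` gives equal profiles.

Quotients: a nontrivial normal subgroup contains the centre or lies in it. Modulo a nontrivial
central subgroup at most one form `lam (r * det)` survives, and a rescaling removes `r`.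

Isomorphism classes: an isomorphism makes `c'` a conjugate of a fractional linear transform of `c`.
So at most `p(p² - 1)e` of the `p ^ e - p` parameters share a class. -/

/-- The set `V × Z` with the product `(v, z) (w, z') = (v + w, z + z' + B v w)`. -/
@[ext]
structure CocycleGroup {R : Type*} {V : Type u} {Z : Type v} [CommRing R] [AddCommGroup V]
    [AddCommGroup Z] [Module R V] [Module R Z] (B : V →ₗ[R] V →ₗ[R] Z) where
  /-- the component in the quotient -/
  fst : V
  /-- the component in the central subgroup -/
  snd : Z

namespace CocycleGroup

section Basic

variable {R : Type*} {V : Type u} {Z : Type v} [CommRing R] [AddCommGroup V]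
  [AddCommGroup Z] [Module R V] [Module R Z] {B B' : V →ₗ[R] V →ₗ[R] Z}

instance : Mul (CocycleGroup B) := ⟨fun x y => ⟨x.fst + y.fst, x.snd + y.snd + B x.fst y.fst⟩⟩

instance : One (CocycleGroup B) := ⟨⟨0, 0⟩⟩

instance : Inv (CocycleGroup B) := ⟨fun x => ⟨-x.fst, -x.snd + B x.fst x.fst⟩⟩

@[simp] theorem mul_fst (x y : CocycleGroup B) : (x * y).fst = x.fst + y.fst := rfl

@[simp] theorem mul_snd (x y : CocycleGroup B) :
    (x * y).snd = x.snd + y.snd + B x.fst y.fst := rfl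

@[simp] theorem one_fst : (1 : CocycleGroup B).fst = 0 := rfl

@[simp] theorem one_snd : (1 : CocycleGroup B).snd = 0 := rfl

@[simp] theorem inv_fst (x : CocycleGroup B) : x⁻¹.fst = -x.fst := rfl

@[simp] theorem inv_snd (x : CocycleGroup B) : x⁻¹.snd = -x.snd + B x.fst x.fst := rfl

instance : Group (CocycleGroup B) :=
  Group.ofLeftAxioms
    (fun x y z => by ext <;> simp <;> abel)
    (fun x => by ext <;> simp)
    (fun x => by ext <;> simp)

/-- The underlying set of a cocycle group is the product. -/
def equivProd (B : V →ₗ[R] V →ₗ[R] Z) : CocycleGroup B ≃ V × Z where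
  toFun x := (x.fst, x.snd)
  invFun x := ⟨x.1, x.2⟩

instance [Finite V] [Finite Z] : Finite (CocycleGroup B) := Finite.of_equiv _ (equivProd B).symm

theorem card (B : V →ₗ[R] V →ₗ[R] Z) : Nat.card (CocycleGroup B) = Nat.card V * Nat.card Z := by
  rw [Nat.card_congr (equivProd B), Nat.card_prod]

theorem mk_mul_mk (v w : V) (z z' : Z) :
    (⟨v, z⟩ * ⟨w, z'⟩ : CocycleGroup B) = ⟨v + w, z + z' + B v w⟩ := rfl

theorem inv_mk_mul_mk (v : V) (z z' : Z) :
    ((⟨v, z⟩ : CocycleGroup B)⁻¹ * ⟨v, z'⟩) = ⟨0, z' - z⟩ := by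
  ext
  · simp
  · simp; abel

theorem conj_eq (x y : CocycleGroup B) :
    x * y * x⁻¹ = ⟨y.fst, y.snd + (B x.fst y.fst - B y.fst x.fst)⟩ := by
  ext
  · simp
  · simp; abel

theorem conj_eq_mul (x y : CocycleGroup B) :
    x * y * x⁻¹ = y * ⟨0, B x.fst y.fst - B y.fst x.fst⟩ := by
  rw [conj_eq]
  ext <;> simp

theorem commutatorElement_eq (x y : CocycleGroup B) :
    ⁅x, y⁆ = ⟨0, B x.fst y.fst - B y.fst x.fst⟩ := by
  rw [commutatorElement_def]
  ext
  · simp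
  · simp; abel

theorem mem_center_iff (x : CocycleGroup B) :
    x ∈ Subgroup.center (CocycleGroup B) ↔ ∀ w, B x.fst w = B w x.fst := by
  rw [Subgroup.mem_center_iff]
  constructor
  · intro h w
    have := congrArg snd (h ⟨w, 0⟩)
    simpa using this.symm
  · intro h y
    ext
    · simp [add_comm]
    · simp [h, add_comm]

/-- A subgroup projecting onto `V` is everything when each element of `Z` is a commutator. -/
theorem eq_top_of_fst_surjective (hB : ∀ z, ∃ v w, B v w - B w v = z)
    (K : Subgroup (CocycleGroup B)) (hK : ∀ v, ∃ x ∈ K, x.fst = v) : K = ⊤ := by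
  have hZ : ∀ z : Z, (⟨0, z⟩ : CocycleGroup B) ∈ K := by
    intro z
    obtain ⟨v, w, rfl⟩ := hB z
    obtain ⟨x, hx, rfl⟩ := hK v
    obtain ⟨y, hy, rfl⟩ := hK w
    rw [← commutatorElement_eq, commutatorElement_def]
    exact K.mul_mem (K.mul_mem (K.mul_mem hx hy) (K.inv_mem hx)) (K.inv_mem hy)
  rw [eq_top_iff]
  intro y _
  obtain ⟨x, hx, hxy⟩ := hK y.fst
  have : y = x * ⟨0, y.snd - x.snd⟩ := by
    ext
    · simp [hxy]
    · simp
  rw [this]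
  exact K.mul_mem hx (hZ _)

/-- The image of a subgroup in `V`. -/
def fstImage (K : Subgroup (CocycleGroup B)) : AddSubgroup V where
  carrier := {v | ∃ x ∈ K, x.fst = v}
  zero_mem' := ⟨1, K.one_mem, rfl⟩
  add_mem' := by
    rintro _ _ ⟨x, hx, rfl⟩ ⟨y, hy, rfl⟩
    exact ⟨x * y, K.mul_mem hx hy, rfl⟩
  neg_mem' := by
    rintro _ ⟨x, hx, rfl⟩
    exact ⟨x⁻¹, K.inv_mem hx, rfl⟩

/-- Transport of a subgroup along `(v, z) ↦ (f v, z)`, when `f` relates the two cocycles on the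
image of the subgroup in `V`. -/
def twist (f : V ≃ₗ[R] V) (K : Subgroup (CocycleGroup B))
    (hK : ∀ x ∈ K, ∀ y ∈ K, B' (f x.fst) (f y.fst) = B x.fst y.fst) :
    Subgroup (CocycleGroup B') where
  carrier := {y | (⟨f.symm y.fst, y.snd⟩ : CocycleGroup B) ∈ K}
  one_mem' := by
    have : (⟨f.symm (1 : CocycleGroup B').fst, (1 : CocycleGroup B').snd⟩ : CocycleGroup B) =
        1 := by
      ext <;> simp
    rw [Set.mem_ofPred_eq, this]
    exact K.one_mem
  mul_mem' := by
    intro x y hx hy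
    have h := hK _ hx _ hy
    have := K.mul_mem hx hy
    rw [mk_mul_mk, ← h] at this
    simpa using this
  inv_mem' := by
    intro x hx
    have h := hK _ hx _ hx
    have := K.inv_mem hx
    simp only [Set.mem_ofPred_eq]
    convert this using 1
    ext
    · simp
    · simpa using h

theorem mem_twist {f : V ≃ₗ[R] V} {K : Subgroup (CocycleGroup B)}
    {hK : ∀ x ∈ K, ∀ y ∈ K, B' (f x.fst) (f y.fst) = B x.fst y.fst} {y : CocycleGroup B'} :
    y ∈ twist f K hK ↔ (⟨f.symm y.fst, y.snd⟩ : CocycleGroup B) ∈ K := Iff.rfl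

/-- The twisted subgroup is isomorphic to the original one. -/
def twistEquiv (f : V ≃ₗ[R] V) (K : Subgroup (CocycleGroup B))
    (hK : ∀ x ∈ K, ∀ y ∈ K, B' (f x.fst) (f y.fst) = B x.fst y.fst) :
    K ≃* twist f K hK where
  toFun x := ⟨⟨f x.1.fst, x.1.snd⟩, by rw [mem_twist, f.symm_apply_apply]; exact x.2⟩
  invFun y := ⟨⟨f.symm y.1.fst, y.1.snd⟩, y.2⟩
  left_inv x := by simp
  right_inv y := by simp
  map_mul' x y := by
    apply Subtype.ext
    ext
    · simp
    · simp [hK _ x.2 _ y.2]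

/-- A normal subgroup, seen as a subgroup for another cocycle on the same set. -/
def sameCarrier (B' : V →ₗ[R] V →ₗ[R] Z) (K : Subgroup (CocycleGroup B))
    (hK : (∀ x ∈ K, x.fst = 0) ∨ ∀ z, (⟨0, z⟩ : CocycleGroup B) ∈ K) :
    Subgroup (CocycleGroup B') where
  carrier := {y | (⟨y.fst, y.snd⟩ : CocycleGroup B) ∈ K}
  one_mem' := K.one_mem
  mul_mem' := by
    intro x y hx hy
    have := K.mul_mem hx hy
    -- Over `0` both cocycles vanish; if `K` contains `Z`, their difference is absorbed by `K`.
    rcases hK with hK | hK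
    · simp only [Set.mem_ofPred_eq] at hx hy ⊢
      have h0 : x.fst = 0 := hK _ hx
      convert this using 1
      ext <;> simp [h0]
    · have h := K.mul_mem this (hK (B' x.fst y.fst - B x.fst y.fst))
      simp only [Set.mem_ofPred_eq]
      convert h using 1
      ext <;> simp
  inv_mem' := by
    intro x hx
    have := K.inv_mem hx
    rcases hK with hK | hK
    · simp only [Set.mem_ofPred_eq] at hx ⊢
      have h0 : x.fst = 0 := hK _ hx
      convert this using 1
      ext <;> simp [h0]
    · have h := K.mul_mem this (hK (B' x.fst x.fst - B x.fst x.fst))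
      simp only [Set.mem_ofPred_eq]
      convert h using 1
      ext <;> simp

theorem mem_sameCarrier {K : Subgroup (CocycleGroup B)}
    {hK : (∀ x ∈ K, x.fst = 0) ∨ ∀ z, (⟨0, z⟩ : CocycleGroup B) ∈ K} {y : CocycleGroup B'} :
    y ∈ sameCarrier B' K hK ↔ (⟨y.fst, y.snd⟩ : CocycleGroup B) ∈ K := Iff.rfl

theorem sameCarrier_normal {K : Subgroup (CocycleGroup B)}
    (hK : (∀ x ∈ K, x.fst = 0) ∨ ∀ z, (⟨0, z⟩ : CocycleGroup B) ∈ K) :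
    (sameCarrier B' K hK).Normal := by
  constructor
  intro x hx y
  rw [conj_eq, mem_sameCarrier]
  rw [mem_sameCarrier] at hx
  rcases hK with hK | hK
  · have h0 : x.fst = 0 := hK _ hx
    simpa [h0] using hx
  · have h := K.mul_mem hx (hK (B' y.fst x.fst - B' x.fst y.fst))
    convert h using 1
    ext <;> simp

theorem sameCarrier_ne_bot {K : Subgroup (CocycleGroup B)}
    (hK : (∀ x ∈ K, x.fst = 0) ∨ ∀ z, (⟨0, z⟩ : CocycleGroup B) ∈ K) (h : K ≠ ⊥) :
    sameCarrier B' K hK ≠ ⊥ := by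
  obtain ⟨x, hx, hx1⟩ := K.bot_or_exists_ne_one.resolve_left h
  intro hbot
  have : (⟨x.fst, x.snd⟩ : CocycleGroup B') ∈ sameCarrier B' K hK := hx
  rw [hbot, Subgroup.mem_bot] at this
  apply hx1
  ext
  · simpa using congrArg fst this
  · simpa using congrArg snd this

/-- An automorphism of `V` relating two cocycles modulo a normal subgroup with the same carrier
gives isomorphic quotients. -/
theorem nonempty_quotient_mulEquiv {K : Subgroup (CocycleGroup B)} {K' : Subgroup (CocycleGroup B')}
    [K.Normal] [K'.Normal] (f : V ≃ₗ[R] V)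
    (hf : ∀ v z, (⟨f v, z⟩ : CocycleGroup B') ∈ K' ↔ (⟨v, z⟩ : CocycleGroup B) ∈ K)
    (h : ∀ v w, (⟨0, B' (f v) (f w) - B v w⟩ : CocycleGroup B') ∈ K') :
    Nonempty (CocycleGroup B ⧸ K ≃* CocycleGroup B' ⧸ K') := by
  let ψ : CocycleGroup B →* CocycleGroup B' ⧸ K' :=
    MonoidHom.mk' (fun x => QuotientGroup.mk ⟨f x.fst, x.snd⟩) (by
      intro x y
      have e : (⟨f (x * y).fst, (x * y).snd⟩ : CocycleGroup B')⁻¹ *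
          (⟨f x.fst, x.snd⟩ * ⟨f y.fst, y.snd⟩) = ⟨0, B' (f x.fst) (f y.fst) - B x.fst y.fst⟩ := by
        rw [mk_mul_mk (B := B') (f x.fst) (f y.fst), ← map_add, ← mul_fst,
          inv_mk_mul_mk (B := B') (f (x * y).fst), mul_snd]
        congr 1
        abel
      exact QuotientGroup.eq.mpr (e ▸ h x.fst y.fst))
  have hker : ψ.ker = K := by
    ext x
    rw [MonoidHom.mem_ker]
    exact (QuotientGroup.eq_one_iff _).trans (hf _ _)
  have hsurj : Function.Surjective ψ := by
    intro y
    obtain ⟨y, rfl⟩ := QuotientGroup.mk_surjective y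
    refine ⟨⟨f.symm y.fst, y.snd⟩, ?_⟩
    show ((⟨f (f.symm y.fst), y.snd⟩ : CocycleGroup B') : CocycleGroup B' ⧸ K') = _
    rw [f.apply_symm_apply]
  exact ⟨(QuotientGroup.quotientMulEquivOfEq hker.symm).trans
    (QuotientGroup.quotientKerEquivOfSurjective ψ hsurj)⟩

end Basic

end CocycleGroup

/-! ### Counting -/

/-- Each `x` spreads a total weight of `1` evenly over the nonempty set of `φ` related to it;
exchanging the two sums gives the count. -/
theorem card_eq_sum_fiberwise {X Φ : Type*} [Fintype X] [Fintype Φ]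
    (R : X → Φ → Prop) [∀ φ, Fintype {x // R x φ}] (hR : ∀ x, ∃ φ, R x φ) :
    (Fintype.card X : ℚ) = ∑ φ, ∑ x : {x // R x φ}, (1 / (Nat.card {ψ // R x.1 ψ} : ℚ)) := by
  classical
  have h1 : ∀ φ, ∑ x : {x // R x φ}, (1 / (Nat.card {ψ // R x.1 ψ} : ℚ)) =
      ∑ x, if R x φ then (1 / (Nat.card {ψ // R x ψ} : ℚ)) else 0 := by
    intro φ
    rw [← Finset.sum_filter]
    exact (Finset.sum_subtype _ (by simp)
      (fun x => (1 / (Nat.card {ψ // R x ψ} : ℚ)))).symm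
  simp only [h1]
  rw [Finset.sum_comm, Fintype.card_eq_sum_ones, Nat.cast_sum]
  refine Finset.sum_congr rfl fun x _ => ?_
  rw [← Finset.sum_filter, Finset.sum_const, nsmul_eq_mul, Nat.card_eq_fintype_card,
    Fintype.card_subtype]
  obtain ⟨φ, hφ⟩ := hR x
  have : ((Finset.univ.filter (R x)).card : ℚ) ≠ 0 := by
    rw [Nat.cast_ne_zero, Finset.card_ne_zero]
    exact ⟨φ, by simpa using hφ⟩
  field_simp
  simp

/-- If every element of `X` and of `Y` is related to some `φ`, and the sets of elements related to
`φ` are in bijection by maps preserving the number of related `ψ`, then `X` and `Y` have the same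
size. -/
theorem card_eq_of_fiberwise_equiv {X Y Φ : Type*} [Finite X] [Finite Y] [Finite Φ]
    (R : X → Φ → Prop) (R' : Y → Φ → Prop) (hR : ∀ x, ∃ φ, R x φ) (hR' : ∀ y, ∃ φ, R' y φ)
    (E : ∀ φ, {x // R x φ} ≃ {y // R' y φ})
    (hE : ∀ φ x, Nat.card {ψ // R' (E φ x).1 ψ} = Nat.card {ψ // R x.1 ψ}) :
    Nat.card X = Nat.card Y := by
  classical
  have := Fintype.ofFinite X
  have := Fintype.ofFinite Y
  have := Fintype.ofFinite Φ
  have hX := card_eq_sum_fiberwise R hR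
  have hY := card_eq_sum_fiberwise R' hR'
  rw [Nat.card_eq_fintype_card, Nat.card_eq_fintype_card]
  have : (Fintype.card X : ℚ) = Fintype.card Y := by
    rw [hX, hY]
    refine Finset.sum_congr rfl fun φ _ => ?_
    rw [← (E φ).sum_comp]
    exact Finset.sum_congr rfl fun x _ => by rw [hE]
  exact_mod_cast this

/-! ### Invariance of the profiles under isomorphism. -/

theorem SameSubgroupProfile.of_mulEquiv {G₁ G₂ : Type u} [Group G₁] [Group G₂] (f : G₁ ≃* G₂) :
    SameSubgroupProfile G₁ G₂ := by
  intro J _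
  refine Nat.card_congr (f.mapSubgroup.toEquiv.subtypeEquiv fun K => ?_)
  have hK : K ≃* K.map f.toMonoidHom := K.equivMapOfInjective f.toMonoidHom f.injective
  have htop : f.mapSubgroup.toEquiv K ≠ ⊤ ↔ K ≠ ⊤ := by
    refine not_congr ?_
    exact map_eq_top_iff f.mapSubgroup
  rw [htop]
  refine and_congr_right fun _ => ?_
  exact ⟨fun ⟨g⟩ => ⟨hK.symm.trans g⟩, fun ⟨g⟩ => ⟨hK.trans g⟩⟩

theorem SameQuotientProfile.of_mulEquiv {G₁ G₂ : Type u} [Group G₁] [Group G₂] (f : G₁ ≃* G₂) :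
    SameQuotientProfile G₁ G₂ := by
  intro J _
  refine Nat.card_congr (f.mapSubgroup.toEquiv.subtypeEquiv fun K => ?_)
  have hbot : f.mapSubgroup.toEquiv K ≠ ⊥ ↔ K ≠ ⊥ := by
    refine not_congr ?_
    exact map_eq_bot_iff f.mapSubgroup
  rw [hbot]
  refine and_congr_right fun _ => ?_
  constructor
  · rintro ⟨hn, ⟨g⟩⟩
    have hn' : (K.map (f : G₁ →* G₂)).Normal := hn.map _ f.surjective
    exact ⟨hn', ⟨(QuotientGroup.congr K _ f rfl).symm.trans g⟩⟩
  · rintro ⟨hn, ⟨g⟩⟩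
    have hn' : K.Normal := by
      have h2 : (K.map (f : G₁ →* G₂)).Normal := hn
      have := h2.comap (f : G₁ →* G₂)
      rwa [Subgroup.comap_map_eq_self_of_injective f.injective] at this
    have h2 : (K.map (f : G₁ →* G₂)).Normal := hn
    exact ⟨hn', ⟨(QuotientGroup.congr K _ f rfl).trans g⟩⟩

theorem SameSubgroupProfile.trans {G₁ G₂ G₃ : Type u} [Group G₁] [Group G₂] [Group G₃]
    (h : SameSubgroupProfile G₁ G₂) (h' : SameSubgroupProfile G₂ G₃) :
    SameSubgroupProfile G₁ G₃ := fun J _ => (h J).trans (h' J)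

theorem SameQuotientProfile.trans {G₁ G₂ G₃ : Type u} [Group G₁] [Group G₂] [Group G₃]
    (h : SameQuotientProfile G₁ G₂) (h' : SameQuotientProfile G₂ G₃) :
    SameQuotientProfile G₁ G₃ := fun J _ => (h J).trans (h' J)

namespace CocycleGroup

/-! ### Profiles and rank of a cocycle group over `ZMod p`. -/

section Profiles

variable {p : ℕ} [Fact p.Prime] {V : Type u} {Z : Type v} [AddCommGroup V]
  [AddCommGroup Z] [Module (ZMod p) V] [Module (ZMod p) Z]
  {B B' : V →ₗ[ZMod p] V →ₗ[ZMod p] Z}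

/-- A nonzero functional on `V` which vanishes on a subgroup. -/
def Kills (K : Subgroup (CocycleGroup B)) (φ : Dual (ZMod p) V) : Prop :=
  φ ≠ 0 ∧ ∀ x ∈ K, φ x.fst = 0

theorem Kills.ne_top {K : Subgroup (CocycleGroup B)} {φ : Dual (ZMod p) V} (h : Kills K φ) :
    K ≠ ⊤ := by
  rintro rfl
  exact h.1 (LinearMap.ext fun v => h.2 ⟨v, 0⟩ trivial)

/-- By `eq_top_of_fst_surjective` a proper subgroup has a proper image in `V`, and a proper subspace
lies in a hyperplane. -/
theorem exists_kills (hB : ∀ z, ∃ v w, B v w - B w v = z) {K : Subgroup (CocycleGroup B)}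
    (hK : K ≠ ⊤) : ∃ φ, Kills K φ := by
  have hlt : AddSubgroup.toZModSubmodule p (fstImage K) < ⊤ := by
    rw [lt_top_iff_ne_top]
    intro h
    refine hK (eq_top_of_fst_surjective hB K fun v => ?_)
    have : v ∈ AddSubgroup.toZModSubmodule p (fstImage K) := by rw [h]; trivial
    exact this
  obtain ⟨φ, hφ, hle⟩ := Submodule.exists_le_ker_of_lt_top _ hlt
  exact ⟨φ, hφ, fun x hx => hle (show x.fst ∈ AddSubgroup.toZModSubmodule p (fstImage K) from
    ⟨x, hx, rfl⟩)⟩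

theorem kills_twist_iff {f : V ≃ₗ[ZMod p] V} {K : Subgroup (CocycleGroup B)}
    {hK : ∀ x ∈ K, ∀ y ∈ K, B' (f x.fst) (f y.fst) = B x.fst y.fst} {φ : Dual (ZMod p) V} :
    Kills (twist f K hK) φ ↔ Kills K (φ ∘ₗ f) := by
  refine and_congr (not_congr ?_) ?_
  · constructor
    · rintro rfl
      simp
    · intro h
      refine LinearMap.ext fun v => ?_
      simpa using LinearMap.congr_fun h (f.symm v)
  · constructor
    · intro h x hx
      exact h ⟨f x.fst, x.snd⟩ (by rw [mem_twist, f.symm_apply_apply]; exact hx)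
    · intro h y hy
      simpa using h _ (mem_twist.1 hy)

/-- For each `φ`, twisting by its `f` matches the subgroups killed by `φ`. A subgroup may be killed
by many functionals, so the bijections for different `φ` overlap; `card_eq_of_fiberwise_equiv`
corrects for this by weights. -/
theorem sameSubgroupProfile_of_twists [Finite V] [Finite Z]
    (hB : ∀ z, ∃ v w, B v w - B w v = z) (hB' : ∀ z, ∃ v w, B' v w - B' w v = z)
    (H : ∀ φ : Dual (ZMod p) V, φ ≠ 0 → ∃ f : V ≃ₗ[ZMod p] V, (∀ v, φ (f v) = φ v) ∧
      ∀ v w, φ v = 0 → φ w = 0 → B' (f v) (f w) = B v w) :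
    SameSubgroupProfile (CocycleGroup B) (CocycleGroup B') := by
  classical
  intro J _
  have : Finite (Dual (ZMod p) V) := DFunLike.finite _
  choose! f hf hf' using H
  have t1 : ∀ φ (K : Subgroup (CocycleGroup B)), Kills K φ →
      ∀ x ∈ K, ∀ y ∈ K, B' (f φ x.fst) (f φ y.fst) = B x.fst y.fst :=
    fun φ K h x hx y hy => hf' φ h.1 _ _ (h.2 x hx) (h.2 y hy)
  have t2 : ∀ φ (K : Subgroup (CocycleGroup B')), Kills K φ →
      ∀ x ∈ K, ∀ y ∈ K, B ((f φ).symm x.fst) ((f φ).symm y.fst) = B' x.fst y.fst := by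
    intro φ K h x hx y hy
    have e : ∀ v, φ ((f φ).symm v) = φ v := fun v => by
      rw [← hf φ h.1, LinearEquiv.apply_symm_apply]
    rw [← hf' φ h.1 _ _ ((e _).trans (h.2 x hx)) ((e _).trans (h.2 y hy))]
    simp
  have c1 : ∀ φ, φ ≠ 0 → φ ∘ₗ (f φ : V →ₗ[ZMod p] V) = φ :=
    fun φ h => LinearMap.ext fun v => hf φ h v
  have c2 : ∀ φ, φ ≠ 0 → φ ∘ₗ ((f φ).symm : V →ₗ[ZMod p] V) = φ :=
    fun φ h => LinearMap.ext fun v => by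
      conv_rhs => rw [← (f φ).apply_symm_apply v, hf φ h]
      rfl
  have k1 : ∀ φ (K : Subgroup (CocycleGroup B)) (h : Kills K φ),
      Kills (twist (f φ) K (t1 φ K h)) φ := fun φ K h => by
    rw [kills_twist_iff, c1 φ h.1]; exact h
  have k2 : ∀ φ (K : Subgroup (CocycleGroup B')) (h : Kills K φ),
      Kills (twist (f φ).symm K (t2 φ K h)) φ := fun φ K h => by
    rw [kills_twist_iff, c2 φ h.1]; exact h
  refine card_eq_of_fiberwise_equiv (fun K φ => Kills K.1 φ) (fun K φ => Kills K.1 φ)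
    (fun K => exists_kills hB K.2.1) (fun K => exists_kills hB' K.2.1)
    (fun φ =>
      { toFun := fun K => ⟨⟨twist (f φ) K.1.1 (t1 φ _ K.2), (k1 φ _ K.2).ne_top,
          K.1.2.2.map (twistEquiv _ _ _).symm.trans⟩, k1 φ _ K.2⟩
        invFun := fun K => ⟨⟨twist (f φ).symm K.1.1 (t2 φ _ K.2), (k2 φ _ K.2).ne_top,
          K.1.2.2.map (twistEquiv _ _ _).symm.trans⟩, k2 φ _ K.2⟩
        left_inv := fun K => by
          apply Subtype.ext; apply Subtype.ext; ext x
          simp [mem_twist]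
        right_inv := fun K => by
          apply Subtype.ext; apply Subtype.ext; ext x
          simp [mem_twist] }) ?_
  intro φ K
  -- The weights agree because `ψ ↦ ψ ∘ f` carries the functionals killing the twist onto those
  -- killing `K`.
  exact Nat.card_congr ((f φ).dualMap.toEquiv.subtypeEquiv fun ψ =>
    kills_twist_iff (hK := t1 φ _ K.2))

/-- Criterion for the quotient profile: every nontrivial normal subgroup lies in, or contains, the
subgroup `Z`, and in both cases it is matched by a normal subgroup with the same carrier. -/
theorem quotientProfile_le [Finite V] [Finite Z] (Q : Type (max u v)) [Group Q]
    (H : ∀ K : Subgroup (CocycleGroup B), K.Normal → K ≠ ⊥ →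
      ((∀ x ∈ K, x.fst = 0) ∨ ∀ z, (⟨0, z⟩ : CocycleGroup B) ∈ K) ∧
      ∃ f : V ≃ₗ[ZMod p] V, (∀ v z, (⟨f v, z⟩ : CocycleGroup B) ∈ K ↔ ⟨v, z⟩ ∈ K) ∧
        ∀ v w, (⟨0, B' (f v) (f w) - B v w⟩ : CocycleGroup B) ∈ K) :
    quotientProfile (CocycleGroup B) Q ≤ quotientProfile (CocycleGroup B') Q := by
  refine Nat.card_le_card_of_injective
    (fun K => ⟨sameCarrier B' K.1 (H K.1 K.2.2.fst K.2.1).1, sameCarrier_ne_bot _ K.2.1,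
      sameCarrier_normal _, ?_⟩) ?_
  · obtain ⟨K, hK, hn, ⟨g⟩⟩ := K
    obtain ⟨h1, f, hf, h⟩ := H K hn hK
    have := sameCarrier_normal (B' := B') h1
    obtain ⟨i⟩ := nonempty_quotient_mulEquiv (K := K) (K' := sameCarrier B' K h1) f hf h
    exact ⟨i.symm.trans g⟩
  · intro K L hKL
    apply Subtype.ext
    ext x
    have := congrArg (fun M => (⟨x.fst, x.snd⟩ : CocycleGroup B') ∈ M.1) hKL
    exact iff_of_eq this

/-- Lifts of a basis of `V` generate, since their commutators supply `Z`; conversely, generators of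
the group project to a spanning set of `V`. -/
theorem rank_eq [Finite V] [Finite Z] (hB : ∀ z, ∃ v w, B v w - B w v = z) :
    Group.rank (CocycleGroup B) = finrank (ZMod p) V := by
  classical
  apply le_antisymm
  · let b := finBasis (ZMod p) V
    have hS : Subgroup.closure
        ((Finset.univ.image fun i => (⟨b i, 0⟩ : CocycleGroup B) : Finset _) :
        Set (CocycleGroup B)) = ⊤ := by
      refine eq_top_of_fst_surjective hB _ fun v => ?_
      have hle : Submodule.span (ZMod p) (Set.range b) ≤ AddSubgroup.toZModSubmodule p (fstImage
          (Subgroup.closure ((Finset.univ.image fun i => (⟨b i, 0⟩ : CocycleGroup B) : Finset _) :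
        Set (CocycleGroup B)))) := by
        rw [Submodule.span_le]
        rintro _ ⟨i, rfl⟩
        exact ⟨⟨b i, 0⟩, Subgroup.subset_closure (by simp), rfl⟩
      exact hle (by rw [b.span_eq]; trivial)
    refine (Group.rank_le hS).trans (Finset.card_image_le.trans ?_)
    simp
  · obtain ⟨S, hS, hS'⟩ := Group.rank_spec (CocycleGroup B)
    rw [← hS]
    have hspan : Submodule.span (ZMod p) ((S.image fst : Finset V) : Set V) = ⊤ := by
      rw [eq_top_iff]
      intro v _
      have hall : ∀ x ∈ Subgroup.closure (S : Set (CocycleGroup B)),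
          x.fst ∈ Submodule.span (ZMod p) ((S.image fst : Finset V) : Set V) := by
        intro x hx
        induction hx using Subgroup.closure_induction with
        | mem x hx => exact Submodule.subset_span (by simpa using ⟨x, hx, rfl⟩)
        | one => exact Submodule.zero_mem _
        | mul x y _ _ hx hy => exact Submodule.add_mem _ hx hy
        | inv x _ hx => exact Submodule.neg_mem _ hx
      exact hall ⟨v, 0⟩ (by rw [hS']; trivial)
    have := finrank_span_finset_le_card (R := ZMod p) (S.image (fst : CocycleGroup B → V))
    rw [Set.finrank, hspan, finrank_top] at this
    exact this.trans Finset.card_image_le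

end Profiles

end CocycleGroup

/-! ### The pairs of alternating forms on `F × F`. -/

section Forms

variable {p : ℕ} [Fact p.Prime] {F : Type u} [Field F] [Algebra (ZMod p) F]

/-- The determinant form on `F × F`. -/
def symp : (F × F) →ₗ[ZMod p] (F × F) →ₗ[ZMod p] F :=
  LinearMap.mk₂ (ZMod p) (fun v w => v.1 * w.2 - v.2 * w.1)
    (by intro a b c; simp; ring) (by intro r a b; simp [smul_sub])
    (by intro a b c; simp; ring) (by intro r a b; simp [smul_sub])

@[simp] theorem symp_apply (v w : F × F) : symp (p := p) v w = v.1 * w.2 - v.2 * w.1 := rfl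

theorem symp_swap (v w : F × F) : symp (p := p) w v = -symp (p := p) v w := by
  simp; ring

/-- The pair of functionals `z ↦ lam z` and `z ↦ lam (c * z)`. -/
def coords (lam : Dual (ZMod p) F) (c : F) : F →ₗ[ZMod p] ZMod p × ZMod p :=
  lam.prod (lam ∘ₗ LinearMap.mulLeft (ZMod p) c)

@[simp] theorem coords_apply (lam : Dual (ZMod p) F) (c z : F) :
    coords lam c z = (lam z, lam (c * z)) := rfl

/-- The pair of alternating forms attached to `c`. -/
def form (lam : Dual (ZMod p) F) (c : F) : (F × F) →ₗ[ZMod p] (F × F) →ₗ[ZMod p] ZMod p × ZMod p :=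
  symp.compr₂ (coords lam c)

theorem form_apply (lam : Dual (ZMod p) F) (c : F) (v w : F × F) :
    form lam c v w = coords lam c (symp (p := p) v w) := rfl

theorem form_sub_swap (lam : Dual (ZMod p) F) (c : F) (v w : F × F) :
    form lam c v w - form lam c w v = coords lam c (2 * symp (p := p) v w) := by
  rw [form_apply, form_apply, symp_swap v w, ← map_sub]
  congr 1
  ring

theorem exists_symp_eq {v : F × F} (hv : v ≠ 0) (z : F) : ∃ w, symp (p := p) v w = z := by
  by_cases h : v.1 = 0
  · have h2 : v.2 ≠ 0 := fun h2 => hv (Prod.ext h h2)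
    exact ⟨(-z / v.2, 0), by simp; field_simp⟩
  · exact ⟨(0, z / v.1), by simp; field_simp⟩

theorem eq_zero_of_dual_mul {lam : Dual (ZMod p) F} (hlam : lam ≠ 0) {x : F}
    (h : ∀ z, lam (x * z) = 0) : x = 0 := by
  by_contra hx
  exact hlam (LinearMap.ext fun z => by simpa [hx] using h (x⁻¹ * z))

theorem add_mul_ne_zero {c : F} (hc : c ∉ (algebraMap (ZMod p) F).range) {s t : ZMod p}
    (h : s ≠ 0 ∨ t ≠ 0) : algebraMap _ F s + algebraMap _ F t * c ≠ 0 := by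
  intro h0
  by_cases ht : t = 0
  · subst ht
    simp at h0
    simp [h0] at h
  · have ht' : algebraMap _ F t ≠ 0 := by simpa using ht
    refine hc ⟨-s / t, ?_⟩
    rw [map_div₀, map_neg, div_eq_iff ht']
    linear_combination -h0

/-- A functional with coefficients `s`, `t` vanishing on the image satisfies `lam ((s + t c) z) = 0`
for all `z`. Then `s + t c = 0`, which is impossible for `c` outside the prime field. -/
theorem coords_surjective {lam : Dual (ZMod p) F} (hlam : lam ≠ 0) {c : F}
    (hc : c ∉ (algebraMap (ZMod p) F).range) : Function.Surjective (coords lam c) := by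
  rw [← LinearMap.range_eq_top]
  by_contra hne
  obtain ⟨φ, hφ, hle⟩ := Submodule.exists_le_ker_of_lt_top _ (lt_top_iff_ne_top.2 hne)
  have hφ' : ∀ x y, φ (x, y) = x * φ (1, 0) + y * φ (0, 1) := by
    intro x y
    rw [← smul_eq_mul, ← smul_eq_mul, ← map_smul, ← map_smul, ← map_add]
    simp
  refine add_mul_ne_zero hc (s := φ (1, 0)) (t := φ (0, 1)) ?_ ?_
  · by_contra! h
    exact hφ (LinearMap.ext fun ⟨x, y⟩ => by simp [hφ' x y, h])
  · refine eq_zero_of_dual_mul hlam fun z => ?_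
    have h1 : φ (lam z, lam (c * z)) = 0 := hle ⟨z, rfl⟩
    rw [hφ'] at h1
    rw [add_mul, mul_assoc, ← Algebra.smul_def, ← Algebra.smul_def, map_add, map_smul, map_smul,
      smul_eq_mul, smul_eq_mul]
    linear_combination h1

/-- Stronger than surjectivity of the commutator map: one fixed noncentral element already yields
all of `Z`. This forces the dichotomy for normal subgroups. -/
theorem exists_commutator_eq (h2 : (2 : F) ≠ 0) {lam : Dual (ZMod p) F} (hlam : lam ≠ 0) {c : F}
    (hc : c ∉ (algebraMap (ZMod p) F).range) {v : F × F} (hv : v ≠ 0) (z : ZMod p × ZMod p) :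
    ∃ w, form lam c v w - form lam c w v = z := by
  obtain ⟨x, rfl⟩ := coords_surjective hlam hc z
  obtain ⟨w, hw⟩ := exists_symp_eq (p := p) hv (x / 2)
  refine ⟨w, ?_⟩
  rw [form_sub_swap, hw]
  congr 1
  field_simp

theorem exists_commutator_eq' (h2 : (2 : F) ≠ 0) {lam : Dual (ZMod p) F} (hlam : lam ≠ 0) {c : F}
    (hc : c ∉ (algebraMap (ZMod p) F).range) (z : ZMod p × ZMod p) :
    ∃ v w, form lam c v w - form lam c w v = z :=
  ⟨(1, 0), exists_commutator_eq h2 hlam hc (by simp) z⟩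

/-! ### Normal subgroups -/

theorem normal_subgroup_dichotomy (h2 : (2 : F) ≠ 0) {lam : Dual (ZMod p) F} (hlam : lam ≠ 0)
    {c : F} (hc : c ∉ (algebraMap (ZMod p) F).range) (K : Subgroup (CocycleGroup (form lam c)))
    (hK : K.Normal) :
    (∀ x ∈ K, x.fst = 0) ∨ ∀ z, (⟨0, z⟩ : CocycleGroup (form lam c)) ∈ K := by
  by_contra! h
  obtain ⟨⟨x, hx, hx0⟩, z, hz⟩ := h
  obtain ⟨w, hw⟩ := exists_commutator_eq h2 hlam hc hx0 (-z)
  apply hz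
  have h1 := K.mul_mem (K.inv_mem hx) (hK.conj_mem x hx ⟨w, 0⟩)
  rw [CocycleGroup.conj_eq_mul, inv_mul_cancel_left] at h1
  convert h1 using 2
  rw [← neg_sub, hw, neg_neg]

theorem exists_isometry_mod_normal {lam : Dual (ZMod p) F}
    {c c' : F} (hc : c ∉ (algebraMap (ZMod p) F).range)
    (hc' : c' ∉ (algebraMap (ZMod p) F).range) (K : Subgroup (CocycleGroup (form lam c)))
    (hK : (∀ x ∈ K, x.fst = 0) ∨ ∀ z, (⟨0, z⟩ : CocycleGroup (form lam c)) ∈ K) (hbot : K ≠ ⊥) :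
    ∃ f : (F × F) ≃ₗ[ZMod p] (F × F),
      (∀ v z, (⟨f v, z⟩ : CocycleGroup (form lam c)) ∈ K ↔ ⟨v, z⟩ ∈ K) ∧
        ∀ v w, (⟨0, form lam c' (f v) (f w) - form lam c v w⟩ : CocycleGroup (form lam c)) ∈ K := by
  rcases hK with hK | hK
  · obtain ⟨⟨v, s, t⟩, hx, hx1⟩ := K.bot_or_exists_ne_one.resolve_left hbot
    obtain rfl : v = 0 := hK _ hx
    -- The functional with coefficients `(-t, s)` spans the annihilator of `(s, t)`. It turns the
    -- two forms into `lam (r * symp)` and `lam (r' * symp)`, which scaling one coordinate by `r /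
    -- r'` identifies.
    have hst : -t ≠ 0 ∨ s ≠ 0 := by
      by_contra! h
      obtain ⟨h1, rfl⟩ := h
      obtain rfl : t = 0 := by simpa using h1
      exact hx1 rfl
    have hr := add_mul_ne_zero hc hst
    have hr' := add_mul_ne_zero hc' hst
    set r := algebraMap _ F (-t) + algebraMap _ F s * c with hrdef
    set r' := algebraMap _ F (-t) + algebraMap _ F s * c' with hrdef'
    let f : (F × F) ≃ₗ[ZMod p] (F × F) :=
      { toFun := fun v => (r / r' * v.1, v.2)
        invFun := fun v => (r' / r * v.1, v.2)
        map_add' := fun v w => by ext <;> simp [mul_add]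
        map_smul' := fun a v => by ext <;> simp
        left_inv := fun v => by ext <;> simp; field_simp
        right_inv := fun v => by ext <;> simp; field_simp }
    refine ⟨f, fun v z => ?_, fun v w => ?_⟩
    · have h0 : ∀ v : F × F, v ≠ 0 → (⟨v, z⟩ : CocycleGroup (form lam c)) ∉ K :=
        fun v hv h => hv (hK _ h)
      by_cases hv : v = 0
      · rw [hv, map_zero]
      · exact iff_of_false (h0 _ (by simpa using hv)) (h0 _ hv)
    · have hs : r' * symp (p := p) (f v) (f w) = r * symp (p := p) v w := by
        simp [f]; field_simp
      have hlin : ∀ d z : F, lam ((algebraMap _ F (-t) + algebraMap _ F s * d) * z) =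
          -t * lam z + s * lam (d * z) := by
        intro d z
        rw [add_mul, mul_assoc, ← Algebra.smul_def, ← Algebra.smul_def, map_add, map_smul,
          map_smul, smul_eq_mul, smul_eq_mul]
      have hd := congrArg lam hs
      rw [hrdef, hrdef', hlin, hlin] at hd
      have hpow : ∀ n : ℕ, (⟨0, s, t⟩ : CocycleGroup (form lam c)) ^ n = ⟨0, n * s, n * t⟩ := by
        intro n
        induction n with
        | zero => simp; rfl
        | succ n ih =>
          rw [pow_succ, ih]
          ext <;> simp <;> ring
      have hmul : ∀ a : ZMod p, (⟨0, a * s, a * t⟩ : CocycleGroup (form lam c)) ∈ K := by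
        intro a
        have := K.pow_mem hx a.val
        rwa [hpow, ZMod.natCast_val, ZMod.cast_id] at this
      simp only [form_apply, coords_apply, Prod.mk_sub_mk]
      set A := lam (symp (p := p) (f v) (f w))
      set B := lam (c' * symp (p := p) (f v) (f w))
      set C := lam (symp (p := p) v w)
      set D := lam (c * symp (p := p) v w)
      -- By `hd` the difference `(A - C, B - D)` is annihilated by `(-t, s)`, so it is a multiple of
      -- `(s, t)`.
      by_cases hs0 : s = 0
      · have ht0 : t ≠ 0 := by simpa [hs0] using hst
        convert hmul ((B - D) / t) using 3
        · rw [hs0] at hd ⊢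
          have : A = C := by
            apply mul_left_cancel₀ ht0
            linear_combination -hd
          rw [this]; ring
        · field_simp
      · convert hmul ((A - C) / s) using 3
        · field_simp
        · field_simp
          linear_combination hd
  · exact ⟨LinearEquiv.refl _ _, fun v z => Iff.rfl, fun v w => hK _⟩

variable [Finite F]

/-- Every functional on `F` is of the form `z ↦ lam (x * z)`. -/
noncomputable def dualEquiv {lam : Dual (ZMod p) F} (hlam : lam ≠ 0) :
    F ≃ₗ[ZMod p] Dual (ZMod p) F :=
  LinearEquiv.ofInjectiveOfFinrankEq ((LinearMap.mul (ZMod p) F).compr₂ lam)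
    ((injective_iff_map_eq_zero _).2 fun _ hx =>
      eq_zero_of_dual_mul hlam fun z => LinearMap.congr_fun hx z)
    Subspace.dual_finrank_eq.symm

@[simp] theorem dualEquiv_apply {lam : Dual (ZMod p) F} (hlam : lam ≠ 0) (x z : F) :
    dualEquiv hlam x z = lam (x * z) := rfl

/-! ### Hyperplanes -/

/-- The powers of a generator as a basis. -/
noncomputable def powBasis {e : ℕ} (he : e.Prime) (hF : finrank (ZMod p) F = e) {c : F}
    (hc : c ∉ (algebraMap (ZMod p) F).range) : Basis (Fin e) (ZMod p) F :=
  have hne : Nonempty (Fin e) := ⟨⟨0, he.pos⟩⟩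
  have hdeg : (minpoly (ZMod p) c).natDegree = e := by
    -- Primality of `e` leaves no intermediate field, so `c` generates `F`.
    have hdvd : (minpoly (ZMod p) c).natDegree ∣ e := hF ▸ minpoly.degree_dvd (.of_finite _ c)
    refine ((Nat.dvd_prime he).1 hdvd).resolve_left fun h => hc ?_
    exact minpoly.natDegree_eq_one_iff.1 h
  basisOfLinearIndependentOfCardEqFinrank
    ((linearIndependent_pow (K := ZMod p) c).comp (Fin.cast hdeg.symm) (Fin.cast_injective _))
    (by simp [hF])

theorem powBasis_apply {e : ℕ} (he : e.Prime) (hF : finrank (ZMod p) F = e) {c : F}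
    (hc : c ∉ (algebraMap (ZMod p) F).range) (i : Fin e) :
    powBasis he hF hc i = c ^ (i : ℕ) := by
  simp [powBasis]

/-- A linear map matching multiplication by `c` and by `c'` on a hyperplane. -/
theorem exists_equiv_mul_on_hyperplane {e : ℕ} (he : e.Prime) (hF : finrank (ZMod p) F = e)
    {c c' : F} (hc : c ∉ (algebraMap (ZMod p) F).range)
    (hc' : c' ∉ (algebraMap (ZMod p) F).range) :
    ∃ (θ : F ≃ₗ[ZMod p] F) (μ μ' : Dual (ZMod p) F), μ ≠ 0 ∧ μ' ≠ 0 ∧ (∀ x, μ' (θ x) = μ x) ∧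
      ∀ x, μ x = 0 → θ (c * x) = c' * θ x := by
  let b := powBasis he hF hc
  let b' := powBasis he hF hc'
  have hb : ∀ i, b i = c ^ (i : ℕ) := powBasis_apply he hF hc
  have hb' : ∀ i, b' i = c' ^ (i : ℕ) := powBasis_apply he hF hc'
  let θ := b.equiv b' (Equiv.refl _)
  have hθ : ∀ i, θ (b i) = b' i := fun i => by simp [θ]
  -- Multiplication by `c` shifts the powers, so `θ` commutes with it except at the top power; the
  -- hyperplane is the span of the lower ones.
  let l : Fin e := ⟨e - 1, Nat.sub_lt he.pos one_pos⟩
  refine ⟨θ, b.coord l, b'.coord l, ?_, ?_, ?_, ?_⟩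
  · intro h
    simpa using LinearMap.congr_fun h (b l)
  · intro h
    simpa using LinearMap.congr_fun h (b' l)
  · intro x
    have : (b'.coord l) ∘ₗ (θ : F →ₗ[ZMod p] F) = b.coord l := by
      refine b.ext fun i => ?_
      simp only [LinearMap.comp_apply, LinearEquiv.coe_coe, hθ]
      simp [Finsupp.single_apply]
    exact LinearMap.congr_fun this x
  · intro x hx
    rw [← b.sum_repr x, Finset.mul_sum, map_sum, map_sum, Finset.mul_sum]
    refine Finset.sum_congr rfl fun i _ => ?_
    rw [mul_smul_comm, map_smul, map_smul, mul_smul_comm]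
    by_cases hi : i = l
    · subst hi
      have : b.repr x l = 0 := hx
      rw [this, zero_smul, zero_smul]
    · congr 1
      have hlt : (i : ℕ) + 1 < e := by
        have h1 := i.2
        have h2 : (i : ℕ) ≠ e - 1 := fun h => hi (Fin.ext h)
        omega
      rw [hθ, hb, hb', ← pow_succ', ← pow_succ']
      have h1 := hθ ⟨i + 1, hlt⟩
      rwa [hb, hb'] at h1

/-- Every functional on `F × F` becomes a functional of the second coordinate after an element of
`SL₂(F)`. -/
theorem exists_symp_isometry {μ : Dual (ZMod p) F} (hμ : μ ≠ 0) {φ : Dual (ZMod p) (F × F)}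
    (hφ : φ ≠ 0) : ∃ T : (F × F) ≃ₗ[ZMod p] (F × F), (∀ v, φ v = μ (T v).2) ∧
      ∀ v w, symp (p := p) (T v) (T w) = symp (p := p) v w := by
  obtain ⟨x, hx⟩ := (dualEquiv hμ).surjective (φ ∘ₗ LinearMap.inl _ _ _)
  obtain ⟨y, hy⟩ := (dualEquiv hμ).surjective (φ ∘ₗ LinearMap.inr _ _ _)
  have hφ' : ∀ v, φ v = μ (x * v.1 + y * v.2) := by
    intro v
    have h1 := LinearMap.congr_fun hx v.1
    have h2 := LinearMap.congr_fun hy v.2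
    simp only [dualEquiv_apply, LinearMap.comp_apply, LinearMap.inl_apply,
      LinearMap.inr_apply] at h1 h2
    rw [map_add, h1, h2, ← map_add]
    simp
  -- Complete the row `(x, y)` to a matrix of determinant `1`.
  obtain ⟨s, t, hst⟩ : ∃ s t, s * y - t * x = 1 := by
    by_cases hy0 : y = 0
    · have hx0 : x ≠ 0 := by
        rintro rfl
        subst hy0
        exact hφ (LinearMap.ext fun v => by simp [hφ'])
      exact ⟨0, -1 / x, by field_simp; ring⟩
    · exact ⟨1 / y, 0, by field_simp; ring⟩
  refine ⟨
    { toFun := fun v => (s * v.1 + t * v.2, x * v.1 + y * v.2)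
      invFun := fun v => (y * v.1 - t * v.2, -x * v.1 + s * v.2)
      map_add' := fun v w => by ext <;> simp <;> ring
      map_smul' := fun r v => by ext <;> simp [smul_add]
      left_inv := fun v => by
        ext
        · simp only; linear_combination v.1 * hst
        · simp only; linear_combination v.2 * hst
      right_inv := fun v => by
        ext
        · simp only; linear_combination v.1 * hst
        · simp only; linear_combination v.2 * hst }, hφ', fun v w => ?_⟩
  simp only [symp_apply, LinearEquiv.coe_mk, LinearMap.coe_mk, AddHom.coe_mk]
  linear_combination (v.1 * w.2 - v.2 * w.1) * hst

/-- `η` is the inverse of the adjoint of `θ` for the nondegenerate pairing `lam (a * b)`. -/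
theorem exists_adjoint {lam : Dual (ZMod p) F} (hlam : lam ≠ 0) (θ : F ≃ₗ[ZMod p] F) :
    ∃ η : F ≃ₗ[ZMod p] F, ∀ a b, lam (η a * θ b) = lam (a * b) := by
  refine ⟨(dualEquiv hlam).trans (θ.symm.dualMap.trans (dualEquiv hlam).symm), fun a b => ?_⟩
  rw [← dualEquiv_apply hlam]
  simp

/-- Once `SL₂(F)` has made `φ` depend on the second coordinate alone, `(a, b) ↦ (η a, θ b)` works:
adjointness preserves `lam (a * b)`, and on the hyperplane `θ (c * b) = c' * θ b` preserves `lam (c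
* (a * b))` too. -/
theorem exists_isometry_on_hyperplane {e : ℕ} (he : e.Prime) (hF : finrank (ZMod p) F = e)
    {lam : Dual (ZMod p) F} (hlam : lam ≠ 0)
    {c c' : F} (hc : c ∉ (algebraMap (ZMod p) F).range)
    (hc' : c' ∉ (algebraMap (ZMod p) F).range) {φ : Dual (ZMod p) (F × F)} (hφ : φ ≠ 0) :
    ∃ f : (F × F) ≃ₗ[ZMod p] (F × F), (∀ v, φ (f v) = φ v) ∧
      ∀ v w, φ v = 0 → φ w = 0 → form lam c' (f v) (f w) = form lam c v w := by
  obtain ⟨θ, μ, μ', hμ, hμ', hθ, hmul⟩ := exists_equiv_mul_on_hyperplane he hF hc hc'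
  obtain ⟨η, hη⟩ := exists_adjoint hlam θ
  obtain ⟨T, hT, hTs⟩ := exists_symp_isometry hμ hφ
  obtain ⟨T', hT', hTs'⟩ := exists_symp_isometry hμ' hφ
  let m : (F × F) ≃ₗ[ZMod p] (F × F) := η.prodCongr θ
  have hf : ∀ v, T' ((T.trans (m.trans T'.symm)) v) = (η (T v).1, θ (T v).2) := fun v => by
    simp [m]
  refine ⟨T.trans (m.trans T'.symm), fun v => ?_, fun v w hv hw => ?_⟩
  · rw [hT', hf, hθ, hT]
  · rw [form_apply, form_apply, ← hTs', hf, hf, ← hTs v w]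
    rw [hT] at hv hw
    simp only [coords_apply, symp_apply, Prod.mk.injEq]
    constructor
    · rw [map_sub, map_sub, hη, mul_comm (θ _), hη, mul_comm (T w).1]
    · have h1 : c' * (η (T v).1 * θ (T w).2 - θ (T v).2 * η (T w).1) =
          η (T v).1 * θ (c * (T w).2) - η (T w).1 * θ (c * (T v).2) := by
        rw [hmul _ hv, hmul _ hw]; ring
      rw [h1, map_sub, hη, hη, ← map_sub]
      congr 1
      ring

theorem sameProfiles_form {e : ℕ} (he : e.Prime) (hF : finrank (ZMod p) F = e) (h2 : (2 : F) ≠ 0)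
    {lam : Dual (ZMod p) F} (hlam : lam ≠ 0)
    {c c' : F} (hc : c ∉ (algebraMap (ZMod p) F).range)
    (hc' : c' ∉ (algebraMap (ZMod p) F).range) :
    SameSubgroupProfile (CocycleGroup (form lam c)) (CocycleGroup (form lam c')) ∧
      SameQuotientProfile (CocycleGroup (form lam c)) (CocycleGroup (form lam c')) := by
  constructor
  · exact CocycleGroup.sameSubgroupProfile_of_twists (exists_commutator_eq' h2 hlam hc)
      (exists_commutator_eq' h2 hlam hc')
      (fun φ hφ => exists_isometry_on_hyperplane he hF hlam hc hc' hφ)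
  · have key : ∀ {c c' : F}, c ∉ (algebraMap (ZMod p) F).range →
        c' ∉ (algebraMap (ZMod p) F).range → ∀ (Q : Type u) [Group Q],
        quotientProfile (CocycleGroup (form lam c)) Q ≤
          quotientProfile (CocycleGroup (form lam c')) Q := by
      intro c c' hc hc' Q _
      refine CocycleGroup.quotientProfile_le Q fun K hn hbot => ?_
      have hd := normal_subgroup_dichotomy h2 hlam hc K hn
      exact ⟨hd, exists_isometry_mod_normal hc hc' K hd hbot⟩
    exact fun Q _ => le_antisymm (key hc hc' Q) (key hc' hc Q)

end Forms

/-! ### Coordinates on the Heisenberg group and its commutator subgroup. -/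

section Coordinates

variable {F : Type u} [Field F]

/-- The element of the Heisenberg group with given coordinates. -/
def heisenbergMk (a b z : F) : heisenberg F :=
  ⟨⟨unitri a b z, unitri (-a) (-b) (-z + a * b),
    by rw [unitri_mul, ← unitri_zero]; congr 1 <;> ring,
    by rw [unitri_mul, ← unitri_zero]; congr 1 <;> ring⟩, a, b, z, rfl⟩

/-- The coordinates `(1,2)`, `(2,3)` and `(1,3)`. -/
def heisenbergCoord (h : heisenberg F) : F × F × F :=
  ((h.1 : Matrix (Fin 3) (Fin 3) F) 0 1, (h.1 : Matrix (Fin 3) (Fin 3) F) 1 2,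
    (h.1 : Matrix (Fin 3) (Fin 3) F) 0 2)

@[simp] theorem heisenbergCoord_mk (a b z : F) :
    heisenbergCoord (heisenbergMk a b z) = (a, b, z) := by
  simp [heisenbergCoord, heisenbergMk, unitri]

theorem heisenbergMk_coord (h : heisenberg F) : heisenbergMk (heisenbergCoord h).1
    (heisenbergCoord h).2.1 (heisenbergCoord h).2.2 = h := by
  obtain ⟨h, a, b, z, hh⟩ := h
  apply Subtype.ext
  apply Units.ext
  simp [heisenbergMk, heisenbergCoord, hh, unitri]

/-- The Heisenberg group as a set of triples. -/
def heisenbergEquiv (F : Type u) [Field F] : heisenberg F ≃ F × F × F where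
  toFun := heisenbergCoord
  invFun x := heisenbergMk x.1 x.2.1 x.2.2
  left_inv := heisenbergMk_coord
  right_inv _ := heisenbergCoord_mk _ _ _

theorem heisenbergMk_mul (a b z a' b' z' : F) : heisenbergMk a b z * heisenbergMk a' b' z' =
    heisenbergMk (a + a') (b + b') (z + z' + a * b') := by
  apply Subtype.ext
  apply Units.ext
  exact unitri_mul _ _ _ _ _ _

theorem heisenbergCoord_mul (g h : heisenberg F) : heisenbergCoord (g * h) =
    ((heisenbergCoord g).1 + (heisenbergCoord h).1,
      (heisenbergCoord g).2.1 + (heisenbergCoord h).2.1,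
      (heisenbergCoord g).2.2 + (heisenbergCoord h).2.2 +
        (heisenbergCoord g).1 * (heisenbergCoord h).2.1) := by
  conv_lhs => rw [← heisenbergMk_coord g, ← heisenbergMk_coord h, heisenbergMk_mul]
  simp

theorem heisenbergMk_zero : heisenbergMk (0 : F) 0 0 = 1 := by
  apply Subtype.ext
  apply Units.ext
  exact unitri_zero

theorem mem_commutator_iff (h : heisenberg F) : h ∈ commutator (heisenberg F) ↔
    (heisenbergCoord h).1 = 0 ∧ (heisenbergCoord h).2.1 = 0 := by
  constructor
  · let π : heisenberg F →* Multiplicative (F × F) :=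
      MonoidHom.mk' (fun h => Multiplicative.ofAdd ((heisenbergCoord h).1, (heisenbergCoord h).2.1))
        (fun g h => by rw [heisenbergCoord_mul]; rfl)
    intro hh
    have h1 : π h = 1 := Abelianization.commutator_subset_ker π hh
    have h2 : ((heisenbergCoord h).1, (heisenbergCoord h).2.1) = (0, 0) := h1
    simpa using h2
  · rintro ⟨ha, hb⟩
    have h1 : ⁅heisenbergMk (heisenbergCoord h).2.2 0 0, heisenbergMk 0 1 0⁆ = h := by
      rw [commutatorElement_def, mul_inv_eq_iff_eq_mul, mul_inv_eq_iff_eq_mul]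
      conv_rhs => rw [← heisenbergMk_coord h, ha, hb]
      simp [heisenbergMk_mul]
    rw [← h1, commutator_def]
    exact Subgroup.commutator_mem_commutator trivial trivial

theorem commute_of_mem_commutator {h : heisenberg F} (hh : h ∈ commutator (heisenberg F))
    (g : heisenberg F) : g * h = h * g := by
  rw [mem_commutator_iff] at hh
  apply (heisenbergEquiv F).injective
  show heisenbergCoord _ = heisenbergCoord _
  rw [heisenbergCoord_mul, heisenbergCoord_mul, hh.1, hh.2]
  simp [add_comm]

theorem normal_of_le_commutator {N : Subgroup (heisenberg F)} (hN : N ≤ commutator (heisenberg F)) :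
    N.Normal :=
  ⟨fun n hn g => by rwa [commute_of_mem_commutator (hN hn), mul_inv_cancel_right]⟩

end Coordinates

/-! ### The family as cocycle groups. -/

section Quotients

variable {p : ℕ} [Fact p.Prime] {F : Type u} [Field F] [Algebra (ZMod p) F]

/-- The map `(a, b, z) ↦ ((d a, b), (lam (d (2 z - a b)), lam (c d (2 z - a b))))`. -/
def toCocycleGroup (lam : Dual (ZMod p) F) (d c : F) :
    heisenberg F →* CocycleGroup (form lam c) :=
  -- Passing from `z` to `2z - ab` changes the cocycle `a b'` into `a b' - b a'`; the factor `d` on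
  -- `a` multiplies the determinant by `d`.
  MonoidHom.mk' (fun h => ⟨(d * (heisenbergCoord h).1, (heisenbergCoord h).2.1),
      coords lam c (d * (2 * (heisenbergCoord h).2.2 -
        (heisenbergCoord h).1 * (heisenbergCoord h).2.1))⟩) (by
    intro g h
    rw [heisenbergCoord_mul]
    ext1
    · simp [mul_add]
    · rw [CocycleGroup.mul_snd, form_apply, ← map_add, ← map_add]
      refine congrArg (coords lam c) ?_
      simp only [symp_apply]
      ring)

theorem toCocycleGroup_apply (lam : Dual (ZMod p) F) (d c : F) (h : heisenberg F) :
    toCocycleGroup lam d c h = ⟨(d * (heisenbergCoord h).1, (heisenbergCoord h).2.1),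
      coords lam c (d * (2 * (heisenbergCoord h).2.2 -
        (heisenbergCoord h).1 * (heisenbergCoord h).2.1))⟩ := rfl

theorem mem_ker_toCocycleGroup {lam : Dual (ZMod p) F} {d c : F} (hd : d ≠ 0) (h : heisenberg F) :
    h ∈ (toCocycleGroup lam d c).ker ↔ ((heisenbergCoord h).1 = 0 ∧ (heisenbergCoord h).2.1 = 0) ∧
      coords lam c (d * (2 * (heisenbergCoord h).2.2)) = 0 := by
  rw [MonoidHom.mem_ker, toCocycleGroup_apply, CocycleGroup.ext_iff, CocycleGroup.one_fst,
    CocycleGroup.one_snd, Prod.ext_iff]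
  have h1 : d * (heisenbergCoord h).1 = 0 ↔ (heisenbergCoord h).1 = 0 := by simp [hd]
  simp only [Prod.fst_zero, Prod.snd_zero, h1]
  refine and_congr_right fun h2 => ?_
  rw [h2.1, zero_mul, sub_zero]

theorem toCocycleGroup_surjective (h2 : (2 : F) ≠ 0) {lam : Dual (ZMod p) F} {d c : F} (hd : d ≠ 0)
    (hs : Function.Surjective (coords lam c)) :
    Function.Surjective (toCocycleGroup lam d c) := by
  rintro ⟨⟨a, b⟩, w⟩
  obtain ⟨x, rfl⟩ := hs w
  refine ⟨heisenbergMk (a / d) b ((x / d + a / d * b) / 2), ?_⟩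
  rw [toCocycleGroup_apply, heisenbergCoord_mk]
  have e1 : d * (a / d) = a := by field_simp
  have e2 : d * (2 * ((x / d + a / d * b) / 2) - a / d * b) = x := by field_simp; ring
  simp only [e1, e2]

variable [Finite F]

/-- Every central quotient of the family is the cocycle group of some generator. -/
theorem Kernel.exists_mulEquiv {e : ℕ} (hF : finrank (ZMod p) F = e) (h2 : (2 : F) ≠ 0)
    {lam : Dual (ZMod p) F} (hlam : lam ≠ 0) (N : Kernel p e F) :
    ∃ c, c ∉ (algebraMap (ZMod p) F).range ∧
      Nonempty (N.Quot ≃* CocycleGroup (form lam c)) := by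
  obtain ⟨N, ⟨hN, hidx⟩, hnorm⟩ := N
  have hp : p.Prime := Fact.out
  have hcardF : Nat.card F = p ^ e := by
    rw [← hF, Module.natCard_eq_pow_finrank (K := ZMod p), Nat.card_zmod]
  let A : AddSubgroup F :=
    { carrier := {z | heisenbergMk 0 0 z ∈ N}
      zero_mem' := by
        simp only [Set.mem_ofPred_eq, heisenbergMk_zero]
        exact N.one_mem
      add_mem' := by
        intro a b ha hb
        have := N.mul_mem ha hb
        rw [heisenbergMk_mul] at this
        simpa using this
      neg_mem' := by
        intro a ha
        have := N.inv_mem ha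
        have e1 : (heisenbergMk 0 0 a)⁻¹ = heisenbergMk 0 0 (-a) := by
          rw [inv_eq_iff_mul_eq_one, heisenbergMk_mul, ← heisenbergMk_zero]
          congr 1 <;> simp
        rwa [e1] at this }
  let S : Submodule (ZMod p) F := AddSubgroup.toZModSubmodule p A
  have hS : ∀ z, z ∈ S ↔ heisenbergMk 0 0 z ∈ N := fun z => Iff.rfl
  have hmemN : ∀ h, h ∈ N ↔ ((heisenbergCoord h).1 = 0 ∧ (heisenbergCoord h).2.1 = 0) ∧
      (heisenbergCoord h).2.2 ∈ S := by
    intro h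
    constructor
    · intro hh
      have h1 := (mem_commutator_iff h).1 (hN hh)
      refine ⟨h1, ?_⟩
      rw [hS]
      rwa [← heisenbergMk_coord h, h1.1, h1.2] at hh
    · rintro ⟨⟨h1, h3⟩, h4⟩
      rw [← heisenbergMk_coord h, h1, h3]
      exact h4
  have hcardN : Nat.card N = Nat.card S := Nat.card_congr
    { toFun := fun h => ⟨(heisenbergCoord h.1).2.2, ((hmemN _).1 h.2).2⟩
      invFun := fun z => ⟨heisenbergMk 0 0 z.1, z.2⟩
      left_inv := fun h => by
        apply Subtype.ext
        have h1 := ((hmemN _).1 h.2).1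
        conv_rhs => rw [← heisenbergMk_coord h.1, h1.1, h1.2]
      right_inv := fun z => by simp }
  have hcardQ : Nat.card (F ⧸ S) = p ^ 2 := by
    have e1 : Nat.card S * Nat.card (F ⧸ S) = p ^ e := by
      rw [← hcardF]; exact S.card_eq_card_quotient_mul_card.symm
    have e2 : Nat.card S * p ^ (2 * e + 2) = p ^ e * (p ^ e * p ^ e) := by
      rw [← hcardN, ← hidx, N.card_mul_index, Nat.card_congr (heisenbergEquiv F), Nat.card_prod,
        Nat.card_prod, hcardF]
    have hpos : 0 < Nat.card S * p ^ (2 * e) :=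
      Nat.mul_pos Nat.card_pos (pow_pos hp.pos _)
    apply Nat.eq_of_mul_eq_mul_left hpos
    calc Nat.card S * p ^ (2 * e) * Nat.card (F ⧸ S)
        = Nat.card S * Nat.card (F ⧸ S) * (p ^ e * p ^ e) := by ring
      _ = Nat.card S * p ^ (2 * e) * p ^ 2 := by rw [e1, ← e2]; ring
  have hrank : finrank (ZMod p) (F ⧸ S) = finrank (ZMod p) (ZMod p × ZMod p) := by
    have e1 := Module.natCard_eq_pow_finrank (K := ZMod p) (V := F ⧸ S)
    rw [hcardQ, Nat.card_zmod] at e1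
    simpa using (Nat.pow_right_injective hp.two_le e1).symm
  let g := LinearEquiv.ofFinrankEq _ _ hrank
  -- The two coordinates of `F ⧸ S` are `lam (d * ·)` and `lam (d' * ·)`; the parameter is the ratio
  -- `d' / d`.
  obtain ⟨d, hd⟩ := (dualEquiv hlam).surjective
    (LinearMap.fst _ _ _ ∘ₗ (g : (F ⧸ S) →ₗ[ZMod p] ZMod p × ZMod p) ∘ₗ S.mkQ)
  obtain ⟨d', hd'⟩ := (dualEquiv hlam).surjective
    (LinearMap.snd _ _ _ ∘ₗ (g : (F ⧸ S) →ₗ[ZMod p] ZMod p × ZMod p) ∘ₗ S.mkQ)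
  have hdz : ∀ z, lam (d * z) = (g (S.mkQ z)).1 := fun z => LinearMap.congr_fun hd z
  have hdz' : ∀ z, lam (d' * z) = (g (S.mkQ z)).2 := fun z => LinearMap.congr_fun hd' z
  have hsurj : ∀ w, ∃ z, g (S.mkQ z) = w := fun w => by
    obtain ⟨z, hz⟩ := S.mkQ_surjective (g.symm w)
    exact ⟨z, by simp [hz]⟩
  have hd0 : d ≠ 0 := by
    rintro rfl
    obtain ⟨z, hz⟩ := hsurj (1, 0)
    have h1 := hdz z
    rw [hz] at h1
    simp at h1
  have hcoords : ∀ z, coords lam (d' / d) (d * z) = g (S.mkQ z) := by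
    intro z
    have : d' / d * (d * z) = d' * z := by field_simp
    rw [coords_apply, this, hdz, hdz']
  have hcs : Function.Surjective (coords lam (d' / d)) := fun w => by
    obtain ⟨z, hz⟩ := hsurj w
    exact ⟨d * z, by rw [hcoords, hz]⟩
  refine ⟨d' / d, ?_, ?_⟩
  · rintro ⟨a, ha⟩
    -- If `d' / d` were a scalar `a`, the second coordinate would be `a` times the first.
    obtain ⟨z, hz⟩ := hcs (0, 1)
    rw [coords_apply, ← ha, ← Algebra.smul_def, map_smul, Prod.mk.injEq] at hz
    rw [hz.1] at hz
    simp at hz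
  · have hker : (toCocycleGroup lam d (d' / d)).ker = N := by
      ext h
      rw [mem_ker_toCocycleGroup hd0, hmemN, hcoords]
      refine and_congr_right fun _ => ?_
      have h2' : (2 : ZMod p) ≠ 0 := fun h => h2 (by
        rw [← map_ofNat (algebraMap (ZMod p) F) 2, h, map_zero])
      have e1 : (2 : F) * (heisenbergCoord h).2.2 = (2 : ZMod p) • (heisenbergCoord h).2.2 := by
        rw [Algebra.smul_def, map_ofNat]
      rw [e1, LinearEquiv.map_eq_zero_iff, Submodule.mkQ_apply, Submodule.Quotient.mk_eq_zero,
        S.smul_mem_iff h2']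
    exact ⟨(QuotientGroup.quotientMulEquivOfEq hker.symm).trans
      (QuotientGroup.quotientKerEquivOfSurjective _ (toCocycleGroup_surjective h2 hd0 hcs))⟩

/-- Every generator occurs in the family. -/
theorem exists_kernel_mulEquiv {e : ℕ} (hF : finrank (ZMod p) F = e) (h2 : (2 : F) ≠ 0)
    {lam : Dual (ZMod p) F} (hlam : lam ≠ 0) {c : F} (hc : c ∉ (algebraMap (ZMod p) F).range) :
    ∃ N : Kernel p e F, Nonempty (N.Quot ≃* CocycleGroup (form lam c)) := by
  have hs := toCocycleGroup_surjective h2 one_ne_zero (coords_surjective hlam hc)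
  have hle : (toCocycleGroup lam 1 c).ker ≤ commutator (heisenberg F) := fun h hh =>
    (mem_commutator_iff h).2 ((mem_ker_toCocycleGroup one_ne_zero h).1 hh).1
  have hidx : (toCocycleGroup lam 1 c).ker.index = p ^ (2 * e + 2) := by
    rw [Subgroup.index_ker, MonoidHom.range_eq_top.2 hs, Subgroup.card_top, CocycleGroup.card,
      Nat.card_prod, Nat.card_prod, Nat.card_zmod, Module.natCard_eq_pow_finrank (K := ZMod p),
      Nat.card_zmod, hF]
    ring
  exact ⟨⟨_, ⟨hle, hidx⟩, inferInstance⟩, ⟨QuotientGroup.quotientKerEquivOfSurjective _ hs⟩⟩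

end Quotients

/-! ### Counting isomorphism classes. -/

section Classes

open Polynomial

variable {p : ℕ} [Fact p.Prime] {F : Type u} [Field F] [Algebra (ZMod p) F]

theorem mem_center_form_iff (h2 : (2 : F) ≠ 0) {lam : Dual (ZMod p) F} (hlam : lam ≠ 0) {c : F}
    (hc : c ∉ (algebraMap (ZMod p) F).range) (x : CocycleGroup (form lam c)) :
    x ∈ Subgroup.center (CocycleGroup (form lam c)) ↔ x.fst = 0 := by
  rw [CocycleGroup.mem_center_iff]
  constructor
  · intro h
    by_contra h0
    obtain ⟨w, hw⟩ := exists_commutator_eq h2 hlam hc h0 (1, 0)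
    rw [h, sub_self] at hw
    exact absurd (congrArg Prod.fst hw) (by simp)
  · intro h w
    simp [h]

/-- An isomorphism between two of the cocycle groups gives a linear bijection of `F × F` and a
linear map of `ZMod p × ZMod p` compatible with the commutator forms. -/
theorem exists_linear_of_mulEquiv (h2 : (2 : F) ≠ 0) {lam : Dual (ZMod p) F} (hlam : lam ≠ 0)
    {c c' : F} (hc : c ∉ (algebraMap (ZMod p) F).range)
    (hc' : c' ∉ (algebraMap (ZMod p) F).range)
    (ψ : CocycleGroup (form lam c) ≃* CocycleGroup (form lam c')) :
    ∃ (f : F × F →ₗ[ZMod p] F × F) (g : ZMod p × ZMod p →ₗ[ZMod p] ZMod p × ZMod p),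
      Function.Surjective f ∧ ∀ v w, coords lam c' (2 * symp (p := p) (f v) (f w)) =
        g (coords lam c (2 * symp (p := p) v w)) := by
  have hcen : ∀ z, (ψ ⟨0, z⟩).fst = 0 := by
    intro z
    rw [← mem_center_form_iff h2 hlam hc']
    have h0 : (⟨0, z⟩ : CocycleGroup (form lam c)) ∈ Subgroup.center _ :=
      (mem_center_form_iff h2 hlam hc _).2 rfl
    rw [Subgroup.mem_center_iff] at h0 ⊢
    intro y
    obtain ⟨y, rfl⟩ := ψ.surjective y
    rw [← map_mul, ← map_mul, h0]
  have hfst : ∀ v z, (ψ ⟨v, z⟩).fst = (ψ ⟨v, 0⟩).fst := by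
    intro v z
    have : (⟨v, z⟩ : CocycleGroup (form lam c)) = ⟨v, 0⟩ * ⟨0, z⟩ := by ext1 <;> simp
    rw [this, map_mul, CocycleGroup.mul_fst, hcen, add_zero]
  let f : F × F →+ F × F := AddMonoidHom.mk' (fun v => (ψ ⟨v, 0⟩).fst) (by
    intro v w
    rw [← CocycleGroup.mul_fst, ← map_mul, CocycleGroup.mk_mul_mk, hfst (v + w) (0 + 0 + _)])
  let g : ZMod p × ZMod p →+ ZMod p × ZMod p := AddMonoidHom.mk' (fun z => (ψ ⟨0, z⟩).snd) (by
    intro z z'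
    have : (⟨0, z + z'⟩ : CocycleGroup (form lam c)) = ⟨0, z⟩ * ⟨0, z'⟩ := by ext1 <;> simp
    rw [this, map_mul, CocycleGroup.mul_snd, hcen, hcen, map_zero, add_zero])
  refine ⟨f.toZModLinearMap p, g.toZModLinearMap p, ?_, ?_⟩
  · intro y
    obtain ⟨⟨v, z⟩, hx⟩ := ψ.surjective ⟨y, 0⟩
    refine ⟨v, ?_⟩
    show (ψ ⟨v, 0⟩).fst = y
    rw [← hfst v z, hx]
  · intro v w
    have h1 := map_commutatorElement ψ ⟨v, 0⟩ ⟨w, 0⟩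
    rw [CocycleGroup.commutatorElement_eq, CocycleGroup.commutatorElement_eq, form_sub_swap,
      form_sub_swap] at h1
    exact (congrArg CocycleGroup.snd h1).symm

theorem lam_algebraMap_mul (lam : Dual (ZMod p) F) (s t : ZMod p) (c z : F) :
    lam ((algebraMap _ F s + algebraMap _ F t * c) * z) = s * lam z + t * lam (c * z) := by
  rw [add_mul, mul_assoc, ← Algebra.smul_def, ← Algebra.smul_def, map_add, map_smul, map_smul,
    smul_eq_mul, smul_eq_mul]

/-- If the groups of `c` and `c'` are isomorphic, then `c'` is a root of the minimal polynomial of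
a fractional linear transform of `c`. -/
theorem exists_aeval_minpoly_eq_zero (h2 : (2 : F) ≠ 0) {lam : Dual (ZMod p) F} (hlam : lam ≠ 0)
    {c c' : F} (hc : c ∉ (algebraMap (ZMod p) F).range)
    (hc' : c' ∉ (algebraMap (ZMod p) F).range)
    (ψ : CocycleGroup (form lam c) ≃* CocycleGroup (form lam c')) :
    ∃ r s t u : ZMod p, ∃ x : F, algebraMap _ F r + algebraMap _ F s * c ≠ 0 ∧
      x * (algebraMap _ F r + algebraMap _ F s * c) = algebraMap _ F t + algebraMap _ F u * c ∧
      x ∉ (algebraMap (ZMod p) F).range ∧ aeval c' (minpoly (ZMod p) x) = 0 := by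
  obtain ⟨f, g, hf, hfg⟩ := exists_linear_of_mulEquiv h2 hlam hc hc' ψ
  have hg : ∀ x y, g (x, y) = x • g (1, 0) + y • g (0, 1) := by
    intro x y
    rw [← map_smul, ← map_smul, ← map_add]
    simp
  -- The matrix of `g`, moved inside `lam`, becomes multiplication by `d` and `d'`, both in the span
  -- of `1` and `c`.
  set d := algebraMap _ F (g (1, 0)).1 + algebraMap _ F (g (0, 1)).1 * c with hd
  set d' := algebraMap _ F (g (1, 0)).2 + algebraMap _ F (g (0, 1)).2 * c with hd'
  have h1 : ∀ v w, lam (2 * symp (p := p) (f v) (f w)) = lam (d * (2 * symp (p := p) v w)) := by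
    intro v w
    have := congrArg Prod.fst (hfg v w)
    rw [coords_apply, coords_apply, hg] at this
    rw [hd, lam_algebraMap_mul]
    simp only [Prod.fst_add, Prod.smul_fst, smul_eq_mul] at this
    rw [this]; ring
  have h1' : ∀ v w, lam (c' * (2 * symp (p := p) (f v) (f w))) =
      lam (d' * (2 * symp (p := p) v w)) := by
    intro v w
    have := congrArg Prod.snd (hfg v w)
    rw [coords_apply, coords_apply, hg] at this
    rw [hd', lam_algebraMap_mul]
    simp only [Prod.snd_add, Prod.smul_snd, smul_eq_mul] at this
    rw [this]; ring
  have hnd : ∀ y, (∀ w, lam (2 * symp (p := p) y (f w)) = 0) → y = 0 := by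
    intro y hy
    by_contra hy0
    have : (2 : F) = 0 := eq_zero_of_dual_mul hlam fun z => by
      obtain ⟨w', hw'⟩ := exists_symp_eq (p := p) hy0 z
      obtain ⟨w, rfl⟩ := hf w'
      rw [← hw', hy]
    exact h2 this
  have hd0 : d ≠ 0 := by
    intro h0
    obtain ⟨v, hv⟩ := hf (1, 0)
    have := hnd (f v) fun w => by rw [h1, h0, zero_mul, map_zero]
    rw [hv] at this
    simp at this
  have hx : d' / d * d = d' := by field_simp
  set x := d' / d with hxd
  -- Pairing either side with `f w` gives `lam (d' * (2 * symp v w))`, and by `hnd` the pairing is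
  -- nondegenerate.
  have hfx : ∀ v, f (x • v) = c' • f v := by
    intro v
    rw [← sub_eq_zero]
    refine hnd _ fun w => ?_
    have e1 : 2 * symp (p := p) (f (x • v) - c' • f v) (f w) =
        2 * symp (p := p) (f (x • v)) (f w) - c' * (2 * symp (p := p) (f v) (f w)) := by
      simp; ring
    have e2 : d * (2 * symp (p := p) (x • v) w) = d' * (2 * symp (p := p) v w) := by
      rw [← hx]; simp; ring
    rw [e1, map_sub, h1, h1', e2, sub_self]
  have hfP : ∀ (P : (ZMod p)[X]) v, f (aeval x P • v) = aeval c' P • f v := by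
    intro P
    induction P using Polynomial.induction_on' with
    | add P Q hP hQ => intro v; rw [map_add, map_add, add_smul, add_smul, map_add, hP, hQ]
    | monomial n a =>
      intro v
      have hpow : ∀ n : ℕ, ∀ v, f (x ^ n • v) = c' ^ n • f v := by
        intro n
        induction n with
        | zero => intro v; simp
        | succ n ih => intro v; rw [pow_succ, mul_smul, ih, hfx, pow_succ, mul_smul]
      rw [aeval_monomial, aeval_monomial, ← Algebra.smul_def, ← Algebra.smul_def, smul_assoc,
        smul_assoc, map_smul, hpow]
  obtain ⟨v, hv⟩ := hf (1, 0)
  refine ⟨_, _, _, _, x, hd0, hx, ?_, ?_⟩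
  · rintro ⟨a, ha⟩
    have h3 := hfx v
    rw [← ha, ← algebra_compatible_smul, map_smul, hv] at h3
    refine hc' ⟨a, ?_⟩
    simpa [Algebra.smul_def] using congrArg Prod.fst h3
  · have h3 := hfP (minpoly (ZMod p) x) v
    rw [minpoly.aeval, zero_smul, map_zero, hv] at h3
    simpa using (congrArg Prod.fst h3).symm

/-- Normal forms of fractional linear transformations of `c`. -/
def moebius (c : F) : (ZMod p × (ZMod p)ˣ) ⊕ (ZMod p × ZMod p × (ZMod p)ˣ) → F
  | .inl (s, t) => algebraMap _ F s + algebraMap _ F (t : ZMod p) * c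
  | .inr (r, s, t) => algebraMap _ F s + algebraMap _ F (t : ZMod p) / (algebraMap _ F r + c)

theorem exists_moebius_eq {c x : F} (hx : x ∉ (algebraMap (ZMod p) F).range) {r s t u : ZMod p}
    (h0 : algebraMap _ F r + algebraMap _ F s * c ≠ 0)
    (h : x * (algebraMap _ F r + algebraMap _ F s * c) =
      algebraMap _ F t + algebraMap _ F u * c) :
    ∃ i, moebius (p := p) c i = x := by
  by_cases hs : s = 0
  · subst hs
    have hr : r ≠ 0 := by rintro rfl; simp at h0
    have hr' : algebraMap _ F r ≠ 0 := by simpa using hr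
    have e : algebraMap _ F (t / r) + algebraMap _ F (u / r) * c = x := by
      rw [map_div₀, map_div₀]
      field_simp
      rw [← h]
      simp
      ring
    have hu : u / r ≠ 0 := by
      intro hu
      rw [hu] at e
      exact hx ⟨t / r, by simpa using e⟩
    exact ⟨.inl (t / r, Units.mk0 _ hu), e⟩
  · have hs' : algebraMap _ F s ≠ 0 := by simpa using hs
    have h0' : algebraMap _ F r / algebraMap _ F s + c ≠ 0 := by
      intro h1
      apply h0
      field_simp at h1
      linear_combination h1
    have e : algebraMap _ F (u / s) + algebraMap _ F ((t - u * r / s) / s) /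
        (algebraMap _ F (r / s) + c) = x := by
      simp only [map_div₀, map_sub, map_mul]
      rw [← eq_sub_iff_add_eq', div_eq_iff h0']
      field_simp
      linear_combination -(algebraMap _ F s) * h
    have hu : (t - u * r / s) / s ≠ 0 := by
      intro hu
      rw [hu] at e
      exact hx ⟨u / s, by simpa using e⟩
    exact ⟨.inr (r / s, u / s, Units.mk0 _ hu), e⟩

variable [Finite F]

/-- A fibre of `c ↦ class of c` lies among the roots of the minimal polynomials, of degree at most
`e`, of the `p(p² - 1)` transforms of `c`, a count equal to the order of `PGL₂` over the prime
field. -/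
theorem card_sub_le_card_isoClasses {e : ℕ} (hF : finrank (ZMod p) F = e) (h2 : (2 : F) ≠ 0)
    {lam : Dual (ZMod p) F} (hlam : lam ≠ 0) :
    p ^ e - p ≤ ((p * (p - 1) + p * (p * (p - 1))) * e) * Nat.card (IsoClasses p e F) := by
  classical
  have := Fintype.ofFinite F
  have : Finite (Kernel p e F) := by
    have : Finite (heisenberg F) := Finite.of_equiv _ (heisenbergEquiv F).symm
    exact Subtype.finite
  have := Fintype.ofFinite (IsoClasses p e F)
  let S : Finset F := Finset.univ.filter fun c => c ∉ (algebraMap (ZMod p) F).range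
  have hX : S.card = p ^ e - p := by
    have e1 : Fintype.card F = p ^ e := by
      rw [← Nat.card_eq_fintype_card, Module.natCard_eq_pow_finrank (K := ZMod p), hF,
        Nat.card_zmod]
    have e2 : (Finset.univ.filter fun c => c ∈ (algebraMap (ZMod p) F).range).card = p := by
      have : (Finset.univ.filter fun c => c ∈ (algebraMap (ZMod p) F).range) =
          Finset.univ.image (algebraMap (ZMod p) F) := by
        ext; simp
      rw [this, Finset.card_image_of_injective _ (algebraMap (ZMod p) F).injective,
        Finset.card_univ, ZMod.card]
    rw [← e1, ← Finset.card_univ, ← Finset.card_filter_add_card_filter_not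
      (s := Finset.univ) (p := fun c : F => c ∈ (algebraMap (ZMod p) F).range), e2]
    simp [S]
  have hI : Fintype.card ((ZMod p × (ZMod p)ˣ) ⊕ (ZMod p × ZMod p × (ZMod p)ˣ)) =
      p * (p - 1) + p * (p * (p - 1)) := by
    simp [ZMod.card_units_eq_totient, Nat.totient_prime Fact.out]
  rw [← hX, Nat.card_eq_fintype_card, ← Finset.card_univ]
  -- A nonempty parameter set provides the inhabitant of `Kernel` that `choose!` needs.
  obtain hX0 | ⟨c₀, hc₀⟩ := S.eq_empty_or_nonempty
  · simp [hX0]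
  have : Nonempty (Kernel p e F) :=
    ⟨(exists_kernel_mulEquiv hF h2 hlam (Finset.mem_filter.1 hc₀).2).choose⟩
  choose! N hN using fun c (hc : c ∉ (algebraMap (ZMod p) F).range) =>
    exists_kernel_mulEquiv (e := e) hF h2 hlam hc
  let κ : F → IsoClasses p e F := fun c => Quotient.mk _ (N c)
  refine Finset.card_le_mul_card_image_of_maps_to (f := κ) (fun _ _ => Finset.mem_univ _) _ ?_
  intro q _
  by_cases hq : ∃ c ∈ S, κ c = q
  · obtain ⟨c, hcX, rfl⟩ := hq
    have hc : c ∉ (algebraMap (ZMod p) F).range := (Finset.mem_filter.1 hcX).2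
    have hsub : S.filter (fun c' => κ c' = κ c) ⊆ Finset.univ.biUnion fun i =>
        ((minpoly (ZMod p) (moebius (p := p) c i)).aroots F).toFinset := by
      intro c' h'
      obtain ⟨hc'S, h'⟩ := Finset.mem_filter.1 h'
      have hc' : c' ∉ (algebraMap (ZMod p) F).range := (Finset.mem_filter.1 hc'S).2
      obtain ⟨i⟩ : Nonempty ((N c).Quot ≃* (N c').Quot) := Quotient.exact h'.symm
      obtain ⟨j⟩ := hN c hc
      obtain ⟨k⟩ := hN c' hc'
      obtain ⟨r, s, t, u, x, h0, hx, hxr, hroot⟩ :=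
        exists_aeval_minpoly_eq_zero h2 hlam hc hc' (j.symm.trans (i.trans k))
      obtain ⟨m, rfl⟩ := exists_moebius_eq hxr h0 hx
      rw [Finset.mem_biUnion]
      refine ⟨m, Finset.mem_univ _, ?_⟩
      rw [Multiset.mem_toFinset, mem_aroots]
      exact ⟨minpoly.ne_zero (.of_finite _ _), hroot⟩
    refine (Finset.card_le_card hsub).trans ?_
    rw [← hI, ← Finset.card_univ]
    refine Finset.card_biUnion_le_card_mul _ _ _ fun i _ => ?_
    refine (Multiset.toFinset_card_le _).trans ((card_roots' _).trans ?_)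
    rw [natDegree_map, ← hF]
    exact minpoly.natDegree_le _
  · rw [Finset.card_eq_zero.2]
    · exact Nat.zero_le _
    · rw [Finset.filter_eq_empty_iff]
      exact fun c hc h => hq ⟨c, hc, h⟩

end Classes

/-- With `k = e - 3`, `p ^ k * (p ^ 3 - p) = p ^ e - p ^ (k + 1) ≤ p ^ e - p`; cancel `p ^ 3 - p`.
-/
theorem pow_div_le_of_pow_sub_le {p e n : ℕ} (hp : 2 < p) (he : 2 < e)
    (h : p ^ e - p ≤ ((p * (p - 1) + p * (p * (p - 1))) * e) * n) :
    (p : ℝ) ^ (e - 3) / (e : ℝ) ≤ n := by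
  obtain ⟨k, rfl⟩ : ∃ k, e = k + 3 := ⟨e - 3, by omega⟩
  obtain ⟨q, rfl⟩ : ∃ q, p = q + 1 := ⟨p - 1, by omega⟩
  have hq : 0 < q := by omega
  have h1 : (q + 1) ^ k * ((q + 1) * q + (q + 1) * ((q + 1) * q)) ≤
      (q + 1) ^ (k + 3) - (q + 1) := by
    apply Nat.le_sub_of_add_le
    have : (q + 1) ≤ (q + 1) ^ (k + 1) := Nat.le_self_pow (by omega) _
    calc _ ≤ (q + 1) ^ k * ((q + 1) * q + (q + 1) * ((q + 1) * q)) + (q + 1) ^ (k + 1) := by omega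
      _ = (q + 1) ^ (k + 3) := by ring
  have h2 := h1.trans h
  have h3 : (q + 1) ^ k ≤ (k + 3) * n := by
    refine Nat.le_of_mul_le_mul_right (c := (q + 1) * q + (q + 1) * ((q + 1) * q)) ?_
      (by positivity)
    calc _ ≤ _ := h2
      _ = _ := by rw [Nat.add_sub_cancel]; ring
  rw [div_le_iff₀ (by positivity), Nat.add_sub_cancel, mul_comm]
  exact_mod_cast h3

end HeisenbergProfiles

theorem theorem1p1 (p e : ℕ) (hp : p.Prime) (he : e.Prime) (hp2 : 2 < p) (he2 : 2 < e)
    (F : Type*) [Field F] [Finite F] (hF : Nat.card F = p ^ e) :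
    (∀ N : Subgroup (HeisenbergProfiles.heisenberg F),
      HeisenbergProfiles.IsKernel p e F N → N.Normal) ∧
    (∀ N N' : HeisenbergProfiles.Kernel p e F,
      HeisenbergProfiles.SameSubgroupProfile N.Quot N'.Quot ∧
      HeisenbergProfiles.SameQuotientProfile N.Quot N'.Quot) ∧
    (∀ N : HeisenbergProfiles.Kernel p e F, Group.rank N.Quot = 2 * e) ∧
    (p : ℝ) ^ (e - 3) / (e : ℝ) ≤ (Nat.card (HeisenbergProfiles.IsoClasses p e F) : ℝ) := by
  open HeisenbergProfiles in
  have : Fact p.Prime := ⟨hp⟩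
  have := Fintype.ofFinite F
  have : CharP F p := charP_of_card_eq_prime_pow (f := e) (by rw [← Nat.card_eq_fintype_card, hF])
  let _ : Algebra (ZMod p) F := ZMod.algebra F p
  have hrank : Module.finrank (ZMod p) F = e := by
    have h := Module.natCard_eq_pow_finrank (K := ZMod p) (V := F)
    rw [hF, Nat.card_zmod] at h
    exact (Nat.pow_right_injective hp.two_le h).symm
  have h2 : (2 : F) ≠ 0 := by
    intro h
    have := (CharP.cast_eq_zero_iff F p 2).1 (by exact_mod_cast h)
    exact absurd (Nat.le_of_dvd two_pos this) (by omega)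
  -- Any nonzero functional serves, but it must be the same for all members of the family.
  obtain ⟨lam, hlam⟩ := exists_ne (0 : Module.Dual (ZMod p) F)
  refine ⟨fun N hN => normal_of_le_commutator hN.1, fun N N' => ?_, fun N => ?_, ?_⟩
  · obtain ⟨c, hc, ⟨i⟩⟩ := N.exists_mulEquiv hrank h2 hlam
    obtain ⟨c', hc', ⟨j⟩⟩ := N'.exists_mulEquiv hrank h2 hlam
    obtain ⟨h3, h4⟩ := sameProfiles_form he hrank h2 hlam hc hc'
    exact ⟨((SameSubgroupProfile.of_mulEquiv i).trans h3).trans (.of_mulEquiv j.symm),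
      ((SameQuotientProfile.of_mulEquiv i).trans h4).trans (.of_mulEquiv j.symm)⟩
  · obtain ⟨c, hc, ⟨i⟩⟩ := N.exists_mulEquiv hrank h2 hlam
    rw [Group.rank_congr i, CocycleGroup.rank_eq (exists_commutator_eq' h2 hlam hc),
      Module.finrank_prod, hrank, two_mul]
  · exact pow_div_le_of_pow_sub_le hp2 he2 (card_sub_le_card_isoClasses hrank h2 hlam)
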